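/- Let $\mathcal X,\mathcal U,\mathcal Y$ be complex Hilbert spaces and let $P,T\in\mathcal L(\mathcal X)$, $E\in\mathcal L(\mathcal X,\mathcal Y)$, $N\in\mathcal L(\mathcal X,\mathcal U)$ be such that $P\ge 0$, $P-T^*PT=E^*E-N^*N$, and for every $x\in\mathcal X$ the power series $E(I-zT)^{-1}x=\sum_{n\ge0}z^nET^nx$ and $N(I-zT)^{-1}x=\sum_{n\ge0}z^nNT^nx$ converge on the open unit disk $\mathbb D$. Write $\mathcal S(\mathcal U,\mathcal Y)$ for the Schur class of analytic functions on $\mathbb D$ whose values are contractions in $\mathcal L(\mathcal U,\mathcal Y)$, and $\mathcal H(K_S)$ for the reproducing kernel Hilbert space of $\mathcal Y$-valued functions on $\mathbb D$ with kernel $K_S(z,\zeta)=\frac{I-S(z)S(\zeta)^*}{1-z\bar\zeta}$. Put $\mathcal X_0=\overline{\operatorname{Ran}}\,P^{1/2}$, let $V$ be the isometry from $\mathcal D_V=\overline{\{(P^{1/2}x,Nx):x\in\mathcal X\}}\subseteq\mathcal X_0\oplus\mathcal U$ onto $\mathcal R_V=\overline{\{(P^{1/2}Tx,Ex):x\in\mathcal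 X\}}\subseteq\mathcal X_0\oplus\mathcal Y$ determined by $V(P^{1/2}x,Nx)=(P^{1/2}Tx,Ex)$, let $\Delta=(\mathcal X_0\oplus\mathcal U)\ominus\mathcal D_V$, $\Delta_*=(\mathcal X_0\oplus\mathcal Y)\ominus\mathcal R_V$, and let $\mathbf i:\Delta\to\widetilde\Delta$, $\mathbf i_*:\Delta_*\to\widetilde\Delta_*$ be unitary maps onto Hilbert spaces $\widetilde\Delta,\widetilde\Delta_*$. Let $$\mathbf U=\begin{bmatrix}A&B_1&B_2\\C_1&D_{11}&D_{12}\\C_2&D_{21}&0\end{bmatrix}:\mathcal X_0\oplus\mathcal U\oplus\widetilde\Delta_*\to\mathcal X_0\oplus\mathcal Y\oplus\widetilde\Delta$$ be the unitary operator that acts as $V$ on $\mathcal D_V$, as $\mathbf i$ on $\Delta$ and as $\mathbf i_*^{-1}$ on $\widetilde\Delta_*$, and let $$\Sigma(z)=\begin{bmatrix}\Sigma_{11}(z)&\Sigma_{12}(z)\\\Sigma_{21}(z)&\Sigma_{22}(z)\end{bmatrix}=\begin{bmatrix}D_{11}&D_{12}\\D_{21}&0\end{bmatrix}+z\begin{bmatrix}C_1\\C_2\end{bmatrix}(I-zA)^{-1}\begin{bmatrix}B_1&B_2\end{bmatrix}\qquad(z\in\mathbb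 D).$$ Let $\mathcal E\in\mathcal S(\widetilde\Delta,\widetilde\Delta_*)$ and, on $\mathbb D$, set $$S=\Sigma_{11}+\Sigma_{12}(I-\mathcal E\Sigma_{22})^{-1}\mathcal E\Sigma_{21},\quad G=\Sigma_{12}(I-\mathcal E\Sigma_{22})^{-1},\quad \Gamma(z)=(C_1+G(z)\mathcal E(z)C_2)(I-zA)^{-1}.$$ Then the inverses $(I-zA)^{-1}$ and $(I-\mathcal E(z)\Sigma_{22}(z))^{-1}$ exist for all $z\in\mathbb D$, $S\in\mathcal S(\mathcal U,\mathcal Y)$, the kernels $K_{\mathcal E}$ and $K_S$ are positive, and: (1) multiplication by $G$ is a contraction $M_G:\mathcal H(K_{\mathcal E})\to\mathcal H(K_S)$, the map $M_\Gamma:x\mapsto\Gamma(\cdot)x$ is a contraction $\mathcal X_0\to\mathcal H(K_S)$, and $\begin{bmatrix}M_G&M_\Gamma\end{bmatrix}:\mathcal H(K_{\mathcal E})\oplus\mathcal X_0\to\mathcal H(K_S)$ is a coisometry; (2) for $F^S(z)=(E-S(z)N)(I-zT)^{-1}$ one has $F^S(z)=\Gamma(z)P^{1/2}$ for every $z\in\mathbb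 D$ (with $F^S(z)x=\sum_n z^nET^nx-S(z)\sum_n z^nNT^nx$, and also with the operator inverse $(I-zT)^{-1}$ wherever that exists); (3) let $M_{F^S}=M_\Gamma P^{1/2}$, and let $[*]$ denote the adjoint with respect to the inner product of $\mathcal H(K_S)$. If $M_\Gamma$ is an isometry, then $M_G$ is a partial isometry. The operator $M_\Gamma$ is an isometry if and only if $P=M_{F^S}^{[*]}M_{F^S}$ on $\mathcal X$. Likewise, $M_\Gamma$ is an isometry and $M_G$ is a partial isometry if and only if $P|_{\mathcal X_0}=M_{F^S}^{[*]}M_{F^S}$ with $M_{F^S}$ taken as an operator from $\mathcal X_0$ to $\mathcal H(K_S)$. -/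

import Mathlib

open scoped InnerProductSpace ComplexOrder
open ContinuousLinearMap

noncomputable section

namespace BR

/-! ### Hilbert space direct sums and 2 × 2 block operators -/

/-- The Hilbert space direct sum `H ⊕ K` (with the `ℓ²` norm). -/
abbrev DSum (H K : Type*) := WithLp 2 (H × K)

section Blocks

variable {H H₁ H₂ K K₁ K₂ : Type*}
  [NormedAddCommGroup H] [InnerProductSpace ℂ H]
  [NormedAddCommGroup H₁] [InnerProductSpace ℂ H₁]
  [NormedAddCommGroup H₂] [InnerProductSpace ℂ H₂]
  [NormedAddCommGroup K] [InnerProductSpace ℂ K]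
  [NormedAddCommGroup K₁] [InnerProductSpace ℂ K₁]
  [NormedAddCommGroup K₂] [InnerProductSpace ℂ K₂]

/-- The column operator `[f; g] : H → K₁ ⊕ K₂`. -/
def col (f : H →L[ℂ] K₁) (g : H →L[ℂ] K₂) : H →L[ℂ] DSum K₁ K₂ :=
  ((WithLp.prodContinuousLinearEquiv 2 ℂ K₁ K₂).symm : (K₁ × K₂) →L[ℂ] DSum K₁ K₂) ∘L f.prod g

/-- The row operator `[f g] : H₁ ⊕ H₂ → K`. -/
def row (f : H₁ →L[ℂ] K) (g : H₂ →L[ℂ] K) : DSum H₁ H₂ →L[ℂ] K :=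
  f ∘L WithLp.fstL 2 ℂ H₁ H₂ + g ∘L WithLp.sndL 2 ℂ H₁ H₂

/-- Entry `(1,1)` of a block operator `M : H₁ ⊕ H₂ → K₁ ⊕ K₂`. -/
def b11 (M : DSum H₁ H₂ →L[ℂ] DSum K₁ K₂) : H₁ →L[ℂ] K₁ :=
  WithLp.fstL 2 ℂ K₁ K₂ ∘L M ∘L col (.id ℂ H₁) 0

/-- Entry `(1,2)` of a block operator `M : H₁ ⊕ H₂ → K₁ ⊕ K₂`. -/
def b12 (M : DSum H₁ H₂ →L[ℂ] DSum K₁ K₂) : H₂ →L[ℂ] K₁ :=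
  WithLp.fstL 2 ℂ K₁ K₂ ∘L M ∘L col 0 (.id ℂ H₂)

/-- Entry `(2,1)` of a block operator `M : H₁ ⊕ H₂ → K₁ ⊕ K₂`. -/
def b21 (M : DSum H₁ H₂ →L[ℂ] DSum K₁ K₂) : H₁ →L[ℂ] K₂ :=
  WithLp.sndL 2 ℂ K₁ K₂ ∘L M ∘L col (.id ℂ H₁) 0

/-- Entry `(2,2)` of a block operator `M : H₁ ⊕ H₂ → K₁ ⊕ K₂`. -/
def b22 (M : DSum H₁ H₂ →L[ℂ] DSum K₁ K₂) : H₂ →L[ℂ] K₂ :=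
  WithLp.sndL 2 ℂ K₁ K₂ ∘L M ∘L col 0 (.id ℂ H₂)

/-- `W` is a coisometry: `W W* = I`. -/
def IsCoisometry [CompleteSpace H] [CompleteSpace K] (W : H →L[ℂ] K) : Prop :=
  W ∘L adjoint W = .id ℂ K

/-- `W` is a partial isometry: it is isometric on the orthogonal complement of its kernel. -/
def IsPartialIsometry (W : H →L[ℂ] K) : Prop :=
  ∀ x ∈ (LinearMap.ker (W : H →ₗ[ℂ] K))ᗮ, ‖W x‖ = ‖x‖

end Blocks

/-! ### Schur class functions and de Branges–Rovnyak spaces -/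

section Schur

variable {𝒰 𝒴 : Type*} [NormedAddCommGroup 𝒰] [InnerProductSpace ℂ 𝒰] [CompleteSpace 𝒰]
  [NormedAddCommGroup 𝒴] [InnerProductSpace ℂ 𝒴] [CompleteSpace 𝒴]

/-- The operator-valued Schur class: functions analytic on the open unit disk whose values there
are contractions. Values outside the disk are irrelevant. -/
structure IsSchur (S : ℂ → 𝒰 →L[ℂ] 𝒴) : Prop where
  analytic : DifferentiableOn ℂ S (Metric.ball 0 1)
  contractive : ∀ z ∈ Metric.ball (0 : ℂ) 1, ‖S z‖ ≤ 1

/-- The de Branges–Rovnyak kernel `K_S(z, ζ) = (I - S(z) S(ζ)*) / (1 - z conj ζ)` on the disk. -/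
def brKernel (S : ℂ → 𝒰 →L[ℂ] 𝒴) : Matrix (Metric.ball (0 : ℂ) 1) (Metric.ball (0 : ℂ) 1) (𝒴 →L[ℂ] 𝒴) :=
  .of fun z ζ ↦ (1 - (z : ℂ) * star (ζ : ℂ))⁻¹ • (1 - S z ∘L adjoint (S ζ))

/-- The de Branges–Rovnyak space `H(K_S)`: the reproducing kernel Hilbert space of `𝒴`-valued
functions on the disk whose kernel is the positive kernel `K_S`. -/
def BRSpace (S : ℂ → 𝒰 →L[ℂ] 𝒴) (hS : (brKernel S).PosSemidef) :=
  haveI : Fact (brKernel S).PosSemidef := ⟨hS⟩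
  RKHS.OfKernel (brKernel S)

variable (S : ℂ → 𝒰 →L[ℂ] 𝒴) (hS : (brKernel S).PosSemidef)

instance : NormedAddCommGroup (BRSpace S hS) :=
  haveI : Fact (brKernel S).PosSemidef := ⟨hS⟩
  inferInstanceAs (NormedAddCommGroup (RKHS.OfKernel (brKernel S)))

instance : InnerProductSpace ℂ (BRSpace S hS) :=
  haveI : Fact (brKernel S).PosSemidef := ⟨hS⟩
  inferInstanceAs (InnerProductSpace ℂ (RKHS.OfKernel (brKernel S)))

instance : CompleteSpace (BRSpace S hS) :=
  haveI : Fact (brKernel S).PosSemidef := ⟨hS⟩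
  inferInstanceAs (CompleteSpace (RKHS.OfKernel (brKernel S)))

instance : RKHS ℂ (BRSpace S hS) (Metric.ball (0 : ℂ) 1) 𝒴 :=
  haveI : Fact (brKernel S).PosSemidef := ⟨hS⟩
  inferInstanceAs (RKHS ℂ (RKHS.OfKernel (brKernel S)) (Metric.ball (0 : ℂ) 1) 𝒴)

theorem kernel_BRSpace : RKHS.kernel (BRSpace S hS) = brKernel S :=
  haveI : Fact (brKernel S).PosSemidef := ⟨hS⟩
  RKHS.OfKernel.kernel_ofKernel (K := brKernel S)

end Schur

/-! ### The data set and the unitary colligation -/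

section Data

variable {𝒳 𝒰 𝒴 : Type*}
  [NormedAddCommGroup 𝒳] [InnerProductSpace ℂ 𝒳] [CompleteSpace 𝒳]
  [NormedAddCommGroup 𝒰] [InnerProductSpace ℂ 𝒰] [CompleteSpace 𝒰]
  [NormedAddCommGroup 𝒴] [InnerProductSpace ℂ 𝒴] [CompleteSpace 𝒴]

/-- The observability function `z ↦ E (I - zT)⁻¹ x = ∑ zⁿ E Tⁿ x`, as a power series. -/
def obs (E : 𝒳 →L[ℂ] 𝒴) (T : 𝒳 →L[ℂ] 𝒳) (x : 𝒳) (z : ℂ) : 𝒴 :=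
  ∑' n : ℕ, z ^ n • E ((T ^ n) x)

/-- `(E, T)` is an analytic output pair: for each `x` the power series of `E (I - zT)⁻¹ x`
converges on the whole open unit disk. -/
def IsAnalyticOutputPair (E : 𝒳 →L[ℂ] 𝒴) (T : 𝒳 →L[ℂ] 𝒳) : Prop :=
  ∀ x : 𝒳, ∀ z ∈ Metric.ball (0 : ℂ) 1, Summable fun n : ℕ ↦ z ^ n • E ((T ^ n) x)

/-- Admissible data sets `{P, T, E, N}` of the Schur class abstract interpolation problem. -/
structure IsAdmissible (P T : 𝒳 →L[ℂ] 𝒳) (E : 𝒳 →L[ℂ] 𝒴) (N : 𝒳 →L[ℂ] 𝒰) : Prop where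
  output_E : IsAnalyticOutputPair E T
  output_N : IsAnalyticOutputPair N T
  pos : P.IsPositive
  stein : P - adjoint T ∘L P ∘L T = adjoint E ∘L E - adjoint N ∘L N

/-- `F^S(z) x = E (I - zT)⁻¹ x - S(z) N (I - zT)⁻¹ x`. -/
def FS (T : 𝒳 →L[ℂ] 𝒳) (E : 𝒳 →L[ℂ] 𝒴) (N : 𝒳 →L[ℂ] 𝒰) (S : ℂ → 𝒰 →L[ℂ] 𝒴)
    (z : ℂ) (x : 𝒳) : 𝒴 :=
  obs E T x z - S z (obs N T x z)

/-- `𝒳₀`, the closure of the range of `P^{1/2}`. -/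
abbrev X0 (P : 𝒳 →L[ℂ] 𝒳) : Submodule ℂ 𝒳 :=
  (LinearMap.range ((CFC.sqrt P : 𝒳 →L[ℂ] 𝒳) : 𝒳 →ₗ[ℂ] 𝒳)).topologicalClosure

/-- `P^{1/2}` viewed as an operator from `𝒳` into `𝒳₀`. -/
def sqrtP (P : 𝒳 →L[ℂ] 𝒳) : 𝒳 →L[ℂ] X0 P :=
  (CFC.sqrt P).codRestrict (X0 P) fun x ↦
    Submodule.le_topologicalClosure _ (LinearMap.mem_range_self ((CFC.sqrt P : 𝒳 →L[ℂ] 𝒳) : 𝒳 →ₗ[ℂ] 𝒳) x)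

/-- The domain `𝒟_V`, the closure of `{(P^{1/2} x, N x)}` in `𝒳₀ ⊕ 𝒰`. -/
abbrev domV (P : 𝒳 →L[ℂ] 𝒳) (N : 𝒳 →L[ℂ] 𝒰) : Submodule ℂ (DSum (X0 P) 𝒰) :=
  (LinearMap.range (col (sqrtP P) N : 𝒳 →ₗ[ℂ] DSum (X0 P) 𝒰)).topologicalClosure

/-- The range `ℛ_V`, the closure of `{(P^{1/2} T x, E x)}` in `𝒳₀ ⊕ 𝒴`. -/
abbrev ranV (P T : 𝒳 →L[ℂ] 𝒳) (E : 𝒳 →L[ℂ] 𝒴) : Submodule ℂ (DSum (X0 P) 𝒴) :=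
  (LinearMap.range (col (sqrtP P ∘L T) E : 𝒳 →ₗ[ℂ] DSum (X0 P) 𝒴)).topologicalClosure

/-- The defect space `Δ = (𝒳₀ ⊕ 𝒰) ⊖ 𝒟_V`. -/
abbrev defect (P : 𝒳 →L[ℂ] 𝒳) (N : 𝒳 →L[ℂ] 𝒰) : Submodule ℂ (DSum (X0 P) 𝒰) := (domV P N)ᗮ

/-- The defect space `Δ_* = (𝒳₀ ⊕ 𝒴) ⊖ ℛ_V`. -/
abbrev defectStar (P T : 𝒳 →L[ℂ] 𝒳) (E : 𝒳 →L[ℂ] 𝒴) : Submodule ℂ (DSum (X0 P) 𝒴) :=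
  (ranV P T E)ᗮ

/-- The dense-range map `𝒳 → 𝒟_V`, `x ↦ (P^{1/2} x, N x)`. -/
def toDomV (P : 𝒳 →L[ℂ] 𝒳) (N : 𝒳 →L[ℂ] 𝒰) : 𝒳 →L[ℂ] domV P N :=
  (col (sqrtP P) N).codRestrict (domV P N) fun x ↦
    Submodule.le_topologicalClosure _
      (LinearMap.mem_range_self (col (sqrtP P) N : 𝒳 →ₗ[ℂ] DSum (X0 P) 𝒰) x)

/-- The isometry `V` on `𝒟_V`, as an operator into `𝒳₀ ⊕ 𝒴`: the extension by continuity of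
`(P^{1/2} x, N x) ↦ (P^{1/2} T x, E x)`. -/
def isoV (P T : 𝒳 →L[ℂ] 𝒳) (E : 𝒳 →L[ℂ] 𝒴) (N : 𝒳 →L[ℂ] 𝒰) :
    domV P N →L[ℂ] DSum (X0 P) 𝒴 :=
  LinearMap.extendOfNorm (col (sqrtP P ∘L T) E : 𝒳 →ₗ[ℂ] DSum (X0 P) 𝒴)
    (toDomV P N : 𝒳 →ₗ[ℂ] domV P N)

/-- The isometry identity behind `V`, equivalent to the Stein equation. -/
theorem IsAdmissible.norm_col_eq {P T : 𝒳 →L[ℂ] 𝒳} {E : 𝒳 →L[ℂ] 𝒴} {N : 𝒳 →L[ℂ] 𝒰}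
    (hD : IsAdmissible P T E N) (x : 𝒳) :
    ‖col (sqrtP P ∘L T) E x‖ = ‖col (sqrtP P) N x‖ := by
  have h0 : (0 : 𝒳 →L[ℂ] 𝒳) ≤ P := (ContinuousLinearMap.nonneg_iff_isPositive P).2 hD.pos
  have hsq : CFC.sqrt P * CFC.sqrt P = P := CFC.sqrt_mul_sqrt_self P h0
  have hsa : IsSelfAdjoint (CFC.sqrt P) := (CFC.sqrt_nonneg P).isSelfAdjoint
  have key : ∀ y : 𝒳, ‖sqrtP P y‖ ^ 2 = RCLike.re ⟪P y, y⟫_ℂ := by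
    intro y
    have h1 : ‖sqrtP P y‖ = ‖CFC.sqrt P y‖ := rfl
    have h2 : ⟪P y, y⟫_ℂ = ⟪CFC.sqrt P y, CFC.sqrt P y⟫_ℂ := by
      conv_lhs => rw [← hsq]
      rw [mul_apply_eq_comp]
      conv_lhs => rw [← hsa.adjoint_eq]
      rw [adjoint_inner_left, hsa.adjoint_eq]
    rw [h1, h2, inner_self_eq_norm_sq]
  have hst := congrArg (fun A : 𝒳 →L[ℂ] 𝒳 ↦ RCLike.re ⟪A x, x⟫_ℂ) hD.stein
  simp only [sub_apply, coe_comp, Function.comp_apply, inner_sub_left, adjoint_inner_left,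
    map_sub, inner_self_eq_norm_sq] at hst
  rw [← sq_eq_sq₀ (norm_nonneg _) (norm_nonneg _), WithLp.prod_norm_sq_eq_of_L2,
    WithLp.prod_norm_sq_eq_of_L2]
  have e1 := key x
  have e2 := key (T x)
  change ‖sqrtP P (T x)‖ ^ 2 + ‖E x‖ ^ 2 = ‖sqrtP P x‖ ^ 2 + ‖N x‖ ^ 2
  linarith

theorem denseRange_toDomV (P : 𝒳 →L[ℂ] 𝒳) (N : 𝒳 →L[ℂ] 𝒰) :
    DenseRange (toDomV P N : 𝒳 →ₗ[ℂ] domV P N) := by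
  rw [DenseRange, Subtype.dense_iff]
  rintro y hy
  refine closure_mono ?_ hy
  rintro _ ⟨x, rfl⟩
  exact ⟨toDomV P N x, ⟨x, rfl⟩, rfl⟩

/-- The defining identity of `V`. -/
theorem IsAdmissible.isoV_toDomV {P T : 𝒳 →L[ℂ] 𝒳} {E : 𝒳 →L[ℂ] 𝒴} {N : 𝒳 →L[ℂ] 𝒰}
    (hD : IsAdmissible P T E N) (x : 𝒳) :
    isoV P T E N (toDomV P N x) = col (sqrtP P ∘L T) E x :=
  LinearMap.extendOfNorm_eq (denseRange_toDomV P N)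
    ⟨1, fun x ↦ by rw [one_mul]; exact (hD.norm_col_eq x).le⟩ x

theorem IsAdmissible.norm_isoV {P T : 𝒳 →L[ℂ] 𝒳} {E : 𝒳 →L[ℂ] 𝒴} {N : 𝒳 →L[ℂ] 𝒰}
    (hD : IsAdmissible P T E N) (d : domV P N) : ‖isoV P T E N d‖ = ‖d‖ := by
  refine (denseRange_toDomV P N).induction_on (p := fun d ↦ ‖isoV P T E N d‖ = ‖d‖) d
    (isClosed_eq (by fun_prop) (by fun_prop)) fun x ↦ ?_
  exact (congrArg norm (hD.isoV_toDomV x)).trans (hD.norm_col_eq x)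

variable {Δ Δs : Type*}
  [NormedAddCommGroup Δ] [InnerProductSpace ℂ Δ] [CompleteSpace Δ]
  [NormedAddCommGroup Δs] [InnerProductSpace ℂ Δs] [CompleteSpace Δs]

/-- The colligation `𝐔 : 𝒳₀ ⊕ (𝒰 ⊕ Δ̃_*) → 𝒳₀ ⊕ (𝒴 ⊕ Δ̃)`. In terms of the decompositions
`𝒳₀ ⊕ 𝒰 = 𝒟_V ⊕ Δ` and `𝒳₀ ⊕ 𝒴 = ℛ_V ⊕ Δ_*` it is `V` on `𝒟_V`, the identification `i` from `Δ`
onto `Δ̃`, and the identification `i_*⁻¹` from `Δ̃_*` onto `Δ_*`. -/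
def colligation (P T : 𝒳 →L[ℂ] 𝒳) (E : 𝒳 →L[ℂ] 𝒴) (N : 𝒳 →L[ℂ] 𝒰)
    (i : defect P N ≃ₗᵢ[ℂ] Δ) (is : defectStar P T E ≃ₗᵢ[ℂ] Δs) :
    DSum (X0 P) (DSum 𝒰 Δs) →L[ℂ] DSum (X0 P) (DSum 𝒴 Δ) :=
  let xu : DSum (X0 P) (DSum 𝒰 Δs) →L[ℂ] DSum (X0 P) 𝒰 :=
    col (WithLp.fstL 2 ℂ _ _) (WithLp.fstL 2 ℂ _ _ ∘L WithLp.sndL 2 ℂ _ _)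
  let δs : DSum (X0 P) (DSum 𝒰 Δs) →L[ℂ] Δs := WithLp.sndL 2 ℂ _ _ ∘L WithLp.sndL 2 ℂ _ _
  let xy : DSum (X0 P) (DSum 𝒰 Δs) →L[ℂ] DSum (X0 P) 𝒴 :=
    isoV P T E N ∘L (domV P N).orthogonalProjectionOnto ∘L xu +
      (defectStar P T E).subtypeL ∘L (is.symm : Δs →L[ℂ] defectStar P T E) ∘L δs
  let δ : DSum (X0 P) (DSum 𝒰 Δs) →L[ℂ] Δ :=
    (i : defect P N →L[ℂ] Δ) ∘L (defect P N).orthogonalProjectionOnto ∘L xu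
  col (WithLp.fstL 2 ℂ _ _ ∘L xy) (col (WithLp.sndL 2 ℂ _ _ ∘L xy) δ)

end Data

/-! ### Characteristic function and Redheffer transform -/

section Transform

variable {𝒳₀ 𝒰 𝒴 Δ Δs : Type*}
  [NormedAddCommGroup 𝒳₀] [InnerProductSpace ℂ 𝒳₀] [CompleteSpace 𝒳₀]
  [NormedAddCommGroup 𝒰] [InnerProductSpace ℂ 𝒰] [CompleteSpace 𝒰]
  [NormedAddCommGroup 𝒴] [InnerProductSpace ℂ 𝒴] [CompleteSpace 𝒴]
  [NormedAddCommGroup Δ] [InnerProductSpace ℂ Δ] [CompleteSpace Δ]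
  [NormedAddCommGroup Δs] [InnerProductSpace ℂ Δs] [CompleteSpace Δs]

/-- The characteristic function `D + z C (I - zA)⁻¹ B` of a colligation `[A B; C D]`. -/
def charFun (M : DSum 𝒳₀ 𝒰 →L[ℂ] DSum 𝒳₀ 𝒴) (z : ℂ) : 𝒰 →L[ℂ] 𝒴 :=
  b22 M + z • (b21 M ∘L Ring.inverse (1 - z • b11 M) ∘L b12 M)

/-- `G(z) = Σ₁₂(z) (I - ℰ(z) Σ₂₂(z))⁻¹`. -/
def redG (Sg : ℂ → DSum 𝒰 Δs →L[ℂ] DSum 𝒴 Δ) (ℰ : ℂ → Δ →L[ℂ] Δs) (z : ℂ) : Δs →L[ℂ] 𝒴 :=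
  b12 (Sg z) ∘L Ring.inverse (1 - ℰ z ∘L b22 (Sg z))

/-- The Redheffer transform `ℛ_Σ[ℰ] = Σ₁₁ + Σ₁₂ (I - ℰ Σ₂₂)⁻¹ ℰ Σ₂₁`. -/
def redheffer (Sg : ℂ → DSum 𝒰 Δs →L[ℂ] DSum 𝒴 Δ) (ℰ : ℂ → Δ →L[ℂ] Δs) (z : ℂ) : 𝒰 →L[ℂ] 𝒴 :=
  b11 (Sg z) + b12 (Sg z) ∘L Ring.inverse (1 - ℰ z ∘L b22 (Sg z)) ∘L ℰ z ∘L b21 (Sg z)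

/-- `Γ(z) = (C₁ + G(z) ℰ(z) C₂) (I - zA)⁻¹`, where `A` and `C = [C₁; C₂]` are entries of the
colligation `M`. -/
def redΓ (M : DSum 𝒳₀ (DSum 𝒰 Δs) →L[ℂ] DSum 𝒳₀ (DSum 𝒴 Δ)) (ℰ : ℂ → Δ →L[ℂ] Δs)
    (G : ℂ → Δs →L[ℂ] 𝒴) (z : ℂ) : 𝒳₀ →L[ℂ] 𝒴 :=
  (WithLp.fstL 2 ℂ 𝒴 Δ ∘L b21 M +
      G z ∘L ℰ z ∘L WithLp.sndL 2 ℂ 𝒴 Δ ∘L b21 M) ∘L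
    Ring.inverse (1 - z • b11 M)

end Transform

end BR

end

set_option linter.unusedSectionVars false

namespace BR

/-! ### Factorizations of a reproducing kernel and coisometries. -/

section RKHSLift

variable {X V H K : Type*} [NormedAddCommGroup V] [InnerProductSpace ℂ V] [CompleteSpace V]
  [NormedAddCommGroup H] [InnerProductSpace ℂ H] [CompleteSpace H]
  [NormedAddCommGroup K] [InnerProductSpace ℂ K] [CompleteSpace K] [RKHS ℂ K X V]

/-! Everything rests on one kernel identity. Write `M = [A B; C D]` for the colligation. It glues
the isometry `V` to identifications of the defect spaces along orthogonal decompositions, so it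
preserves norms and is onto, and `M M* = I`. The row `[zC(I - zA)⁻¹, I]` times `M` equals `[C(I -
zA)⁻¹, Σ(z)]`, and multiplying by the adjoint at `ζ` gives `I - Σ(z)Σ(ζ)* = (1 - zζ̄) C(I - zA)⁻¹
(C(I - ζA)⁻¹)*`. The equation `G = Σ₁₂ + GℰΣ₂₂` says likewise that `[I, Gℰ] Σ = [S, G]`. Combining
the two and dividing by `1 - zζ̄` yields `K_S(z,ζ) = G(z) K_ℰ(z,ζ) G(ζ)* + Γ(z) Γ(ζ)*`
(`one_sub_redheffer_comp_adjoint`).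

The inverses exist because `A` is a contraction and because the zero corner of `D` gives `‖Σ₂₂(z)‖ ≤
|z|` by Schwarz's lemma. On the diagonal the identity shows that `S` is contractive. Positivity of
`K_ℰ` and `K_S` is the contractivity of Schur multipliers on the Hardy space, tested on Szegő
kernels. Part (1) then follows from a general fact: a factorization of a kernel through a Hilbert
space induces a coisometry onto the reproducing kernel space (`exists_coisometry_of_kernel_eq`).

For (2), the states `P^{1/2}Tⁿx`, inputs `NTⁿx` and outputs `ETⁿx`, with zero in the auxiliary
channels, form a trajectory of `M`. Its input-output relation (`tendsto_sum_output`), multiplied by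
`[I, Gℰ]`, is `F^S = ΓP^{1/2}`. Part (3) is operator theory: if `M_Γ` is an isometry then `M_G M_G*
= I - M_Γ M_Γ*` is a projection, and isometry of `M_Γ` can be tested on the dense range of
`P^{1/2}`. -/

theorem denseRange_lsum_kerFun :
    DenseRange (Finsupp.lsum ℂ (fun x : X ↦ (RKHS.kerFun K x : V →ₗ[ℂ] K))) := by
  have h := RKHS.kerFun_dense K
  rw [DenseRange, ← LinearMap.coe_range, Submodule.dense_iff_topologicalClosure_eq_top,
    eq_top_iff, ← h]
  refine Submodule.topologicalClosure_mono (Submodule.span_le.2 ?_)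
  rintro _ ⟨x, v, rfl⟩
  exact ⟨Finsupp.single x v, by simp⟩

/-- Both sides are sesquilinear, so the reproducing property on single kernel functions decides.
Equality of these Gram forms makes `k_x v ↦ Φ(x)* v` well defined and isometric. -/
theorem inner_lsum_kerFun (Φ : X → H →L[ℂ] V)
    (hΦ : ∀ x y, RKHS.kernel K x y = Φ x ∘L adjoint (Φ y)) (f g : X →₀ V) :
    ⟪Finsupp.lsum ℂ (fun x : X ↦ (RKHS.kerFun K x : V →ₗ[ℂ] K)) f,
      Finsupp.lsum ℂ (fun x : X ↦ (RKHS.kerFun K x : V →ₗ[ℂ] K)) g⟫_ℂ =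
    ⟪Finsupp.lsum ℂ (fun x : X ↦ (adjoint (Φ x) : V →ₗ[ℂ] H)) f,
      Finsupp.lsum ℂ (fun x : X ↦ (adjoint (Φ x) : V →ₗ[ℂ] H)) g⟫_ℂ := by
  induction f using Finsupp.induction_linear with
  | zero => simp
  | add f₁ f₂ h₁ h₂ => simp only [map_add, inner_add_left, h₁, h₂]
  | single x v =>
    induction g using Finsupp.induction_linear with
    | zero => simp
    | add f₁ f₂ h₁ h₂ => simp only [map_add, inner_add_right, h₁, h₂]
    | single y w =>
      simp only [Finsupp.lsum_single, coe_coe, adjoint_inner_left]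
      rw [RKHS.kerFun_inner, RKHS.kerFun_apply, hΦ]
      rfl

/-- If the reproducing kernel of `K` factors as `Φ x ∘ (Φ y)*` through a Hilbert space `H`, then
`h ↦ (x ↦ Φ x h)` is a coisometry of `H` onto `K`. -/
theorem exists_coisometry_of_kernel_eq (Φ : X → H →L[ℂ] V)
    (hΦ : ∀ x y, RKHS.kernel K x y = Φ x ∘L adjoint (Φ y)) :
    ∃ W : H →L[ℂ] K, (∀ h x, W h x = Φ x h) ∧ IsCoisometry W := by
  set a := Finsupp.lsum ℂ (fun x : X ↦ (RKHS.kerFun K x : V →ₗ[ℂ] K)) with ha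
  set b := Finsupp.lsum ℂ (fun x : X ↦ (adjoint (Φ x) : V →ₗ[ℂ] H)) with hb
  have hab : ∀ f, ‖b f‖ = ‖a f‖ := fun f ↦ by
    rw [@norm_eq_sqrt_re_inner ℂ, @norm_eq_sqrt_re_inner ℂ, inner_lsum_kerFun Φ hΦ]
  -- `J` is the isometry with `k_x v ↦ Φ(x)* v`; its adjoint is the coisometry sought.
  let J : K →L[ℂ] H := LinearMap.extendOfNorm b a
  have hJ : ∀ f, J (a f) = b f := fun f ↦
    LinearMap.extendOfNorm_eq denseRange_lsum_kerFun ⟨1, fun f ↦ by rw [one_mul, hab]⟩ f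
  have hJn : ∀ k, ‖J k‖ = ‖k‖ := fun k ↦
    (denseRange_lsum_kerFun (K := K)).induction_on (p := fun k ↦ ‖J k‖ = ‖k‖) k
      (isClosed_eq (by fun_prop) (by fun_prop)) fun f ↦ by rw [← ha, hJ, hab]
  refine ⟨adjoint J, fun h x ↦ ?_, ?_⟩
  · refine ext_inner_left ℂ fun v ↦ ?_
    have h1 : J (RKHS.kerFun K x v) = adjoint (Φ x) v := by
      have := hJ (Finsupp.single x v)
      simpa [ha, hb] using this
    rw [← RKHS.kerFun_inner, adjoint_inner_right, h1, adjoint_inner_left]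
  · rw [IsCoisometry, adjoint_adjoint]
    exact (norm_map_iff_adjoint_comp_self J).1 hJn

end RKHSLift

/-! ### Positivity of the de Branges–Rovnyak kernel. -/

section SchurKernel

open Metric Real

variable {𝒰 𝒴 : Type*} [NormedAddCommGroup 𝒰] [InnerProductSpace ℂ 𝒰] [CompleteSpace 𝒰]
  [NormedAddCommGroup 𝒴] [InnerProductSpace ℂ 𝒴] [CompleteSpace 𝒴]

theorem one_sub_mul_star_ne_zero {z w : ℂ} (hz : ‖z‖ ≤ 1) (hw : ‖w‖ < 1) :
    1 - z * star w ≠ 0 := by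
  intro h
  have h1 : ‖z * star w‖ = 1 := by rw [← sub_eq_zero.1 h, norm_one]
  rw [norm_mul, norm_star] at h1
  nlinarith [norm_nonneg w, norm_nonneg z]

/-- Cauchy's formula, as the reproducing property of the Szegő kernel. -/
theorem circleAverage_inner_szego {w : ℂ} (hw : ‖w‖ < 1) (y : 𝒴) {h : ℂ → 𝒴}
    (hh : DiffContOnCl ℂ h (ball 0 1)) :
    circleAverage (fun z ↦ ⟪(1 - z * star w)⁻¹ • y, h z⟫_ℂ) 0 1 = ⟪y, h w⟫_ℂ := by
  have hd : DiffContOnCl ℂ (fun z ↦ ⟪y, h z⟫_ℂ) (ball 0 |1|) := by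
    rw [abs_one]
    exact (innerSL ℂ y).differentiable.comp_diffContOnCl hh
  rw [← hd.circleAverage_smul_div (w := w) (by simpa using hw)]
  refine circleAverage_congr_sphere fun z hz ↦ ?_
  have hz1 : ‖z‖ = 1 := by simpa using hz
  -- On the circle `z̄ = 1/z`, which turns the conjugated Szegő kernel `1/(1 - z̄w)` into the Cauchy
  -- factor `z/(z - w)`.
  have hzz : z * star z = 1 := by
    rw [Complex.star_def, Complex.mul_conj, Complex.normSq_eq_norm_sq, hz1]; simp
  have hzw : z - w ≠ 0 := by
    intro h0
    rw [sub_eq_zero.1 h0] at hz1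
    exact hw.ne hz1
  have h2 : 1 - star z * w ≠ 0 := by
    have := one_sub_mul_star_ne_zero (z := star z) (w := star w) (by simp [hz1]) (by simpa using hw)
    simpa using this
  simp only [inner_smul_left, sub_zero, smul_eq_mul]
  congr 1
  have : (starRingEnd ℂ) (1 - z * star w)⁻¹ = (1 - star z * w)⁻¹ := by simp
  rw [this, eq_div_iff hzw, inv_mul_eq_iff_eq_mul₀ h2]
  linear_combination w * hzz

theorem diffContOnCl_szego {w : ℂ} (hw : ‖w‖ < 1) (y : 𝒴) :
    DiffContOnCl ℂ (fun z ↦ (1 - z * star w)⁻¹ • y) (ball 0 1) := by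
  refine DifferentiableOn.diffContOnCl fun z hz ↦ ?_
  rw [closure_ball _ one_ne_zero, mem_closedBall_zero_iff] at hz
  have := one_sub_mul_star_ne_zero hz hw
  fun_prop (disch := assumption)

theorem circleIntegrable_of_continuousOn_closedBall {F : Type*} [NormedAddCommGroup F]
    [NormedSpace ℂ F] {h : ℂ → F} (hh : ContinuousOn h (closedBall 0 1)) : CircleIntegrable h 0 1 :=
  (hh.mono sphere_subset_closedBall).circleIntegrable zero_le_one

theorem circleIntegrable_inner {a b : ℂ → 𝒴} (ha : DiffContOnCl ℂ a (ball 0 1))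
    (hb : DiffContOnCl ℂ b (ball 0 1)) : CircleIntegrable (fun z ↦ ⟪a z, b z⟫_ℂ) 0 1 :=
  circleIntegrable_of_continuousOn_closedBall (ha.continuousOn_ball.inner hb.continuousOn_ball)

theorem diffContOnCl_sum_szego {ι : Type*} (s : Finset ι) (w : ι → ℂ)
    (hw : ∀ i ∈ s, ‖w i‖ < 1) (v : ι → 𝒴) :
    DiffContOnCl ℂ (fun z ↦ ∑ j ∈ s, (1 - z * star (w j))⁻¹ • v j) (ball 0 1) :=
  ⟨DifferentiableOn.fun_sum fun j hj ↦ (diffContOnCl_szego (hw j hj) (v j)).1,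
    continuousOn_finsetSum s fun j hj ↦ (diffContOnCl_szego (hw j hj) (v j)).2⟩

theorem circleAverage_inner_sum_szego {ι : Type*} (s : Finset ι) (w : ι → ℂ)
    (hw : ∀ i ∈ s, ‖w i‖ < 1) (y : ι → 𝒴) {h : ℂ → 𝒴} (hh : DiffContOnCl ℂ h (ball 0 1)) :
    circleAverage (fun z ↦ ⟪∑ i ∈ s, (1 - z * star (w i))⁻¹ • y i, h z⟫_ℂ) 0 1 =
      ∑ i ∈ s, ⟪y i, h (w i)⟫_ℂ := by
  simp only [sum_inner]
  rw [circleAverage_fun_sum]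
  · exact Finset.sum_congr rfl fun i hi ↦ circleAverage_inner_szego (hw i hi) (y i) hh
  · exact fun i hi ↦ circleIntegrable_inner (diffContOnCl_szego (hw i hi) (y i)) hh

/-- A contraction-valued analytic function that extends continuously to the boundary acts
contractively on the Hardy space; tested on Szegő kernels. -/
theorem sum_szego_nonneg_of_diffContOnCl {F : ℂ → 𝒰 →L[ℂ] 𝒴} (hF : DiffContOnCl ℂ F (ball 0 1))
    (hF1 : ∀ z ∈ sphere (0 : ℂ) 1, ‖F z‖ ≤ 1) {ι : Type*} (s : Finset ι) (w : ι → ℂ)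
    (hw : ∀ i ∈ s, ‖w i‖ < 1) (y : ι → 𝒴) :
    0 ≤ RCLike.re (∑ i ∈ s, ∑ j ∈ s, (1 - w i * star (w j))⁻¹ *
      (⟪y i, y j⟫_ℂ - ⟪adjoint (F (w i)) (y i), adjoint (F (w j)) (y j)⟫_ℂ)) := by
  set g : ℂ → 𝒴 := fun z ↦ ∑ j ∈ s, (1 - z * star (w j))⁻¹ • y j with hg
  set f : ℂ → 𝒰 := fun z ↦ ∑ j ∈ s, (1 - z * star (w j))⁻¹ • adjoint (F (w j)) (y j) with hf
  have hgd : DiffContOnCl ℂ g (ball 0 1) := diffContOnCl_sum_szego s w hw y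
  have hfd : DiffContOnCl ℂ f (ball 0 1) :=
    diffContOnCl_sum_szego s w hw fun j ↦ adjoint (F (w j)) (y j)
  have hFf : DiffContOnCl ℂ (fun z ↦ F z (f z)) (ball 0 1) :=
    ⟨hF.1.clm_apply hfd.1, hF.2.clm_apply hfd.2⟩
  have e1 : circleAverage (fun z ↦ ⟪g z, g z⟫_ℂ) 0 1 = ∑ i ∈ s, ⟪y i, g (w i)⟫_ℂ :=
    circleAverage_inner_sum_szego s w hw y hgd
  have e2 : circleAverage (fun z ↦ ⟪g z, F z (f z)⟫_ℂ) 0 1 =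
      ∑ i ∈ s, ⟪y i, F (w i) (f (w i))⟫_ℂ := circleAverage_inner_sum_szego s w hw y hFf
  have e3 : circleAverage (fun z ↦ ⟪f z, f z⟫_ℂ) 0 1 =
      ∑ i ∈ s, ⟪adjoint (F (w i)) (y i), f (w i)⟫_ℂ :=
    circleAverage_inner_sum_szego s w hw (fun j ↦ adjoint (F (w j)) (y j)) hfd
  -- In the Hardy space `f` plays the role of `M_F* g`, so `⟪g, Ff⟫ = ‖f‖²` and the sum `‖g‖² -
  -- ‖f‖²` equals `‖g‖² - 2⟪g, Ff⟫ + ‖f‖²`. The real part of this integrand is at least `‖g - Ff‖²`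
  -- at each point of the circle.
  have hsum : ∑ i ∈ s, ∑ j ∈ s, (1 - w i * star (w j))⁻¹ *
      (⟪y i, y j⟫_ℂ - ⟪adjoint (F (w i)) (y i), adjoint (F (w j)) (y j)⟫_ℂ) =
      circleAverage (fun z ↦ ⟪g z, g z⟫_ℂ - 2 * ⟪g z, F z (f z)⟫_ℂ + ⟪f z, f z⟫_ℂ) 0 1 := by
    have e2' : ∑ i ∈ s, ⟪y i, F (w i) (f (w i))⟫_ℂ =
        ∑ i ∈ s, ⟪adjoint (F (w i)) (y i), f (w i)⟫_ℂ := by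
      simp only [adjoint_inner_left]
    have i2 : CircleIntegrable (fun z ↦ 2 * ⟪g z, F z (f z)⟫_ℂ) 0 1 :=
      (circleIntegrable_inner hgd hFf).const_smul (a := (2 : ℂ))
    have i1 : CircleIntegrable (fun z ↦ ⟪g z, g z⟫_ℂ - 2 * ⟪g z, F z (f z)⟫_ℂ) 0 1 :=
      (circleIntegrable_inner hgd hgd).sub i2
    rw [circleAverage_fun_add i1 (circleIntegrable_inner hfd hfd),
      circleAverage_fun_sub (circleIntegrable_inner hgd hgd) i2]
    have := circleAverage_fun_smul (a := (2 : ℂ)) (f := fun z ↦ ⟪g z, F z (f z)⟫_ℂ) (c := 0)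
      (R := 1)
    simp only [smul_eq_mul] at this
    rw [this, e1, e2, e3, e2']
    simp only [mul_sub, Finset.sum_sub_distrib, hg, hf, inner_sum, inner_smul_right]
    ring
  have hre : RCLike.re (circleAverage
      (fun z ↦ ⟪g z, g z⟫_ℂ - 2 * ⟪g z, F z (f z)⟫_ℂ + ⟪f z, f z⟫_ℂ) 0 1) =
      circleAverage (fun z ↦ RCLike.re
        (⟪g z, g z⟫_ℂ - 2 * ⟪g z, F z (f z)⟫_ℂ + ⟪f z, f z⟫_ℂ)) 0 1 :=
    (Complex.reCLM.circleAverage_comp_comm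
      (((circleIntegrable_inner hgd hgd).sub
        ((circleIntegrable_inner hgd hFf).const_smul (a := (2 : ℂ)))).add
          (circleIntegrable_inner hfd hfd))).symm
  rw [hsum, hre]
  refine circleAverage_nonneg_of_nonneg fun z hz ↦ ?_
  rw [abs_one] at hz
  have h1 := norm_sub_sq (𝕜 := ℂ) (g z) (F z (f z))
  have h2 : ‖F z (f z)‖ ≤ ‖f z‖ := by
    simpa using (F z).le_of_opNorm_le (hF1 z hz) (f z)
  have h3 : RCLike.re (2 * ⟪g z, F z (f z)⟫_ℂ) = 2 * RCLike.re ⟪g z, F z (f z)⟫_ℂ := by simp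
  rw [map_add, map_sub, h3, inner_self_eq_norm_sq, inner_self_eq_norm_sq]
  nlinarith [sq_nonneg ‖g z - F z (f z)‖, norm_nonneg (F z (f z))]

/-- A Schur function may have no continuous boundary values, so the inequality is applied to the
dilations `S(r·)` and `r` tends to `1` from below. The points and Szegő factors stay fixed; only the
values of `S` move. -/
theorem IsSchur.sum_szego_nonneg {S : ℂ → 𝒰 →L[ℂ] 𝒴} (hS : IsSchur S) {ι : Type*} (s : Finset ι)
    (w : ι → ℂ) (hw : ∀ i ∈ s, ‖w i‖ < 1) (y : ι → 𝒴) :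
    0 ≤ RCLike.re (∑ i ∈ s, ∑ j ∈ s, (1 - w i * star (w j))⁻¹ *
      (⟪y i, y j⟫_ℂ - ⟪adjoint (S (w i)) (y i), adjoint (S (w j)) (y j)⟫_ℂ)) := by
  have hlim : ∀ i ∈ s, Filter.Tendsto (fun r : ℝ ↦ adjoint (S (r * w i)) (y i))
      (nhdsWithin 1 (Set.Iio 1)) (nhds (adjoint (S (w i)) (y i))) := by
    intro i hi
    have h1 : ContinuousAt S (w i) := (hS.analytic.differentiableAt
      (isOpen_ball.mem_nhds (by simpa using hw i hi))).continuousAt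
    have h2 : Filter.Tendsto (fun r : ℝ ↦ (r : ℂ) * w i) (nhdsWithin 1 (Set.Iio 1))
        (nhds (w i)) := by
      have : Continuous fun r : ℝ ↦ (r : ℂ) * w i := by fun_prop
      simpa using (this.tendsto 1).mono_left nhdsWithin_le_nhds
    have h3 : Continuous fun A : 𝒰 →L[ℂ] 𝒴 ↦ adjoint A (y i) := by fun_prop
    exact (h3.tendsto _).comp (h1.tendsto.comp h2)
  have hL : Filter.Tendsto (fun r : ℝ ↦ RCLike.re (∑ i ∈ s, ∑ j ∈ s, (1 - w i * star (w j))⁻¹ *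
      (⟪y i, y j⟫_ℂ - ⟪adjoint (S (r * w i)) (y i), adjoint (S (r * w j)) (y j)⟫_ℂ)))
      (nhdsWithin 1 (Set.Iio 1)) (nhds (RCLike.re (∑ i ∈ s, ∑ j ∈ s, (1 - w i * star (w j))⁻¹ *
      (⟪y i, y j⟫_ℂ - ⟪adjoint (S (w i)) (y i), adjoint (S (w j)) (y j)⟫_ℂ)))) := by
    refine (RCLike.continuous_re.tendsto _).comp ?_
    refine tendsto_finsetSum _ fun i hi ↦ tendsto_finsetSum _ fun j hj ↦ ?_
    exact (tendsto_const_nhds.sub ((hlim i hi).inner (hlim j hj))).const_mul _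
  refine ge_of_tendsto hL ?_
  filter_upwards [Ioo_mem_nhdsLT (show (0 : ℝ) < 1 by norm_num)] with r hr
  have hmap : ∀ z ∈ closedBall (0 : ℂ) 1, (r : ℂ) * z ∈ ball (0 : ℂ) 1 := by
    intro z hz
    rw [mem_closedBall_zero_iff] at hz
    rw [mem_ball_zero_iff, norm_mul, Complex.norm_real, Real.norm_of_nonneg hr.1.le]
    nlinarith [hr.1, hr.2, norm_nonneg z]
  refine sum_szego_nonneg_of_diffContOnCl (F := fun z ↦ S (r * z)) ?_ ?_ s w hw y
  · refine DifferentiableOn.diffContOnCl ?_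
    rw [closure_ball _ one_ne_zero]
    exact hS.analytic.comp (by fun_prop) hmap
  · exact fun z hz ↦ hS.contractive _ (hmap z (sphere_subset_closedBall hz))

/-- The de Branges–Rovnyak kernel of a Schur class function is positive. -/
theorem IsSchur.posSemidef_brKernel {S : ℂ → 𝒰 →L[ℂ] 𝒴} (hS : IsSchur S) :
    (brKernel S).PosSemidef := by
  have hiff : (brKernel S).PosSemidef ↔ (brKernel S).IsHermitian ∧
      ∀ v : ball (0 : ℂ) 1 →₀ 𝒴,
        0 ≤ RCLike.re (v.sum fun x w ↦ v.sum fun x' w' ↦ ⟪brKernel S x' x w, w'⟫_ℂ) :=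
    RKHS.posSemidef_tfae.out 0 2
  refine hiff.2 ⟨?_, fun v ↦ ?_⟩
  · ext1 z w
    simp only [Matrix.conjTranspose_apply, brKernel, Matrix.of_apply, star_smul, star_sub, star_one,
      star_inv₀, star_mul, star_star]
    rw [star_eq_adjoint, adjoint_comp, adjoint_adjoint]
  · have h := hS.sum_szego_nonneg v.support (fun z : ball (0 : ℂ) 1 ↦ (z : ℂ))
      (fun z _ ↦ mem_ball_zero_iff.1 z.2) v
    refine h.trans_eq ?_
    simp only [Finsupp.sum]
    congr 1
    refine Finset.sum_congr rfl fun i _ ↦ Finset.sum_congr rfl fun j _ ↦ ?_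
    simp only [brKernel, Matrix.of_apply, smul_apply, sub_apply, one_apply_eq_self,
      inner_smul_left, inner_sub_left, coe_comp, Function.comp_apply, adjoint_inner_right]
    simp [mul_comm]

end SchurKernel

/-! ### Block operators and coisometries. -/

section BlockAlgebra

variable {H H₁ H₂ K K₁ K₂ : Type*}
  [NormedAddCommGroup H] [InnerProductSpace ℂ H]
  [NormedAddCommGroup H₁] [InnerProductSpace ℂ H₁]
  [NormedAddCommGroup H₂] [InnerProductSpace ℂ H₂]
  [NormedAddCommGroup K] [InnerProductSpace ℂ K]
  [NormedAddCommGroup K₁] [InnerProductSpace ℂ K₁]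
  [NormedAddCommGroup K₂] [InnerProductSpace ℂ K₂]

@[simp] theorem col_apply (f : H →L[ℂ] K₁) (g : H →L[ℂ] K₂) (x : H) :
    col f g x = WithLp.toLp 2 (f x, g x) := rfl

@[simp] theorem row_apply (f : H₁ →L[ℂ] K) (g : H₂ →L[ℂ] K) (x : DSum H₁ H₂) :
    row f g x = f x.fst + g x.snd := rfl

theorem toLp_fst_add_snd (x : DSum H₁ H₂) :
    WithLp.toLp 2 (x.fst, (0 : H₂)) + WithLp.toLp 2 ((0 : H₁), x.snd) = x := by
  refine WithLp.ofLp_injective 2 ?_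
  ext <;> simp

theorem row_comp_col (W : DSum H₁ H₂ →L[ℂ] K) :
    row (W ∘L col (.id ℂ H₁) 0) (W ∘L col 0 (.id ℂ H₂)) = W := by
  ext x
  simp only [row_apply, coe_comp, Function.comp_apply, col_apply, id_apply, zero_apply, ← map_add,
    toLp_fst_add_snd]

theorem fst_apply_block (M : DSum H₁ H₂ →L[ℂ] DSum K₁ K₂) (x : DSum H₁ H₂) :
    (M x).fst = b11 M x.fst + b12 M x.snd := by
  conv_lhs => rw [← toLp_fst_add_snd x, map_add]
  rfl

theorem snd_apply_block (M : DSum H₁ H₂ →L[ℂ] DSum K₁ K₂) (x : DSum H₁ H₂) :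
    (M x).snd = b21 M x.fst + b22 M x.snd := by
  conv_lhs => rw [← toLp_fst_add_snd x, map_add]
  rfl

theorem row_comp_block (f : K₁ →L[ℂ] K) (g : K₂ →L[ℂ] K) (M : DSum H₁ H₂ →L[ℂ] DSum K₁ K₂) :
    row f g ∘L M = row (f ∘L b11 M + g ∘L b21 M) (f ∘L b12 M + g ∘L b22 M) := by
  ext x
  simp only [row_apply, coe_comp, Function.comp_apply, fst_apply_block, snd_apply_block, map_add,
    add_apply]
  abel

variable [CompleteSpace H] [CompleteSpace K] [CompleteSpace H₁] [CompleteSpace H₂]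

theorem adjoint_row (f : H₁ →L[ℂ] K) (g : H₂ →L[ℂ] K) :
    adjoint (row f g) = col (adjoint f) (adjoint g) := by
  refine ((eq_adjoint_iff _ _).2 fun x y ↦ ?_).symm
  simp [WithLp.prod_inner_apply, adjoint_inner_left, inner_add_right]

theorem row_comp_adjoint_row (f f' : H₁ →L[ℂ] K) (g g' : H₂ →L[ℂ] K) :
    row f g ∘L adjoint (row f' g') = f ∘L adjoint f' + g ∘L adjoint g' := by
  rw [adjoint_row]
  rfl

theorem IsCoisometry.norm_adjoint_apply {W : H →L[ℂ] K} (hW : IsCoisometry W) (y : K) :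
    ‖adjoint W y‖ = ‖y‖ :=
  (norm_map_iff_adjoint_comp_self (adjoint W)).2 (by rwa [adjoint_adjoint]) y

theorem IsCoisometry.norm_le_one {W : H →L[ℂ] K} (hW : IsCoisometry W) : ‖W‖ ≤ 1 := by
  rw [← LinearIsometryEquiv.norm_map adjoint W]
  exact opNorm_le_bound _ zero_le_one fun y ↦ by rw [hW.norm_adjoint_apply, one_mul]

theorem isCoisometry_of_norm_map_of_surjective {W : H →L[ℂ] K} (hn : ∀ x, ‖W x‖ = ‖x‖)
    (hs : Function.Surjective W) : IsCoisometry W := by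
  have h := (norm_map_iff_adjoint_comp_self W).1 hn
  ext y
  obtain ⟨x, rfl⟩ := hs y
  have := congrArg (fun A : H →L[ℂ] H ↦ W (A x)) h
  simpa using this

omit [CompleteSpace H] [CompleteSpace K] [CompleteSpace H₁] [CompleteSpace H₂] in
theorem norm_comp_col_left_le {W : DSum H₁ H₂ →L[ℂ] K} (hW : ‖W‖ ≤ 1) :
    ‖W ∘L col (.id ℂ H₁) 0‖ ≤ 1 := by
  refine opNorm_le_bound _ zero_le_one fun x ↦ ?_
  refine (W.le_of_opNorm_le hW _).trans_eq ?_
  simp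

omit [CompleteSpace H] [CompleteSpace K] [CompleteSpace H₁] [CompleteSpace H₂] in
theorem norm_comp_col_right_le {W : DSum H₁ H₂ →L[ℂ] K} (hW : ‖W‖ ≤ 1) :
    ‖W ∘L col 0 (.id ℂ H₂)‖ ≤ 1 := by
  refine opNorm_le_bound _ zero_le_one fun x ↦ ?_
  refine (W.le_of_opNorm_le hW _).trans_eq ?_
  simp

omit [CompleteSpace H₁] [CompleteSpace H₂] in
theorem norm_b11_le {M : DSum H₁ H₂ →L[ℂ] DSum K₁ K₂} (hM : ‖M‖ ≤ 1) : ‖b11 M‖ ≤ 1 := by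
  refine opNorm_le_bound _ zero_le_one fun x ↦ ?_
  have h := (M ∘L col (.id ℂ H₁) 0).le_of_opNorm_le (norm_comp_col_left_le hM) x
  exact (WithLp.norm_fst_le _ _).trans h

omit [CompleteSpace H₁] [CompleteSpace H₂] in
theorem norm_b22_le {M : DSum H₁ H₂ →L[ℂ] DSum K₁ K₂} (hM : ‖M‖ ≤ 1) : ‖b22 M‖ ≤ 1 := by
  refine opNorm_le_bound _ zero_le_one fun x ↦ ?_
  have h := (M ∘L col 0 (.id ℂ H₂)).le_of_opNorm_le (norm_comp_col_right_le hM) x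
  exact (WithLp.norm_snd_le _ _).trans h

end BlockAlgebra

/-! ### The characteristic function of a colligation and its kernel identity. -/

section Resolvent

variable {𝒳₀ 𝒰 𝒴 : Type*}
  [NormedAddCommGroup 𝒳₀] [InnerProductSpace ℂ 𝒳₀] [CompleteSpace 𝒳₀]
  [NormedAddCommGroup 𝒰] [InnerProductSpace ℂ 𝒰] [CompleteSpace 𝒰]
  [NormedAddCommGroup 𝒴] [InnerProductSpace ℂ 𝒴] [CompleteSpace 𝒴]

theorem isUnit_one_sub_smul {A : 𝒳₀ →L[ℂ] 𝒳₀} (hA : ‖A‖ ≤ 1) {z : ℂ} (hz : ‖z‖ < 1) :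
    IsUnit (1 - z • A) := by
  refine isUnit_one_sub_of_norm_lt_one ?_
  rw [norm_smul]
  nlinarith [norm_nonneg z, norm_nonneg A]

theorem differentiableOn_inverse {R : Type*} [NormedRing R] [NormedAlgebra ℂ R]
    [HasSummableGeomSeries R] {f : ℂ → R} {s : Set ℂ} (hf : DifferentiableOn ℂ f s) (hu : ∀ z ∈ s, IsUnit (f z)) :
    DifferentiableOn ℂ (fun z ↦ Ring.inverse (f z)) s := fun z hz ↦ by
  obtain ⟨u, hu⟩ := hu z hz
  have := differentiableAt_inverse (𝕜 := ℂ) u.isUnit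
  rw [hu] at this
  exact this.comp_differentiableWithinAt z (hf z hz)

/-- The observability function `z ↦ C (I - zA)⁻¹` of a colligation `[A B; C D]`. -/
noncomputable def obsFun (M : DSum 𝒳₀ 𝒰 →L[ℂ] DSum 𝒳₀ 𝒴) (z : ℂ) : 𝒳₀ →L[ℂ] 𝒴 :=
  b21 M ∘L Ring.inverse (1 - z • b11 M)

theorem charFun_eq (M : DSum 𝒳₀ 𝒰 →L[ℂ] DSum 𝒳₀ 𝒴) (z : ℂ) :
    charFun M z = b22 M + z • (obsFun M z ∘L b12 M) := rfl

theorem differentiableOn_charFun {M : DSum 𝒳₀ 𝒰 →L[ℂ] DSum 𝒳₀ 𝒴} (hM : ‖M‖ ≤ 1) :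
    DifferentiableOn ℂ (charFun M) (Metric.ball 0 1) := by
  have h : DifferentiableOn ℂ (fun z : ℂ ↦ Ring.inverse (1 - z • b11 M)) (Metric.ball 0 1) :=
    differentiableOn_inverse (by fun_prop) fun z hz ↦
      isUnit_one_sub_smul (norm_b11_le hM) (mem_ball_zero_iff.1 hz)
  unfold charFun
  exact (differentiableOn_const _).add (differentiableOn_id.fun_smul
    ((differentiableOn_const _).clm_comp (h.clm_comp (differentiableOn_const _))))

variable {M : DSum 𝒳₀ 𝒰 →L[ℂ] DSum 𝒳₀ 𝒴} {z ζ : ℂ}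

theorem obsFun_comp (hu : IsUnit (1 - z • b11 M)) :
    (z • obsFun M z) ∘L b11 M + b21 M = obsFun M z := by
  have h : Ring.inverse (1 - z • b11 M) * (1 - z • b11 M) = 1 := Ring.inverse_mul_cancel _ hu
  have h2 : obsFun M z ∘L (1 - z • b11 M) = b21 M := by
    rw [obsFun, comp_assoc]
    exact (congrArg (b21 M ∘L ·) h).trans (comp_id _)
  rw [comp_sub, comp_smul] at h2
  rw [smul_comp, ← h2]
  change _ + (obsFun M z ∘L .id ℂ 𝒳₀ - _) = _
  rw [comp_id]
  abel

/-- This carries `M M* = I` over to the characteristic function: multiply by the adjoint of the same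
identity at `ζ`. -/
theorem row_comp_eq_row_obsFun_charFun (hu : IsUnit (1 - z • b11 M)) :
    row (z • obsFun M z) (.id ℂ 𝒴) ∘L M = row (obsFun M z) (charFun M z) := by
  rw [row_comp_block, id_comp, id_comp, obsFun_comp hu, charFun_eq, smul_comp, add_comm (b22 M)]

/-- The kernel identity of a coisometric colligation. -/
theorem charFun_comp_adjoint_charFun (hM : IsCoisometry M) (hz : IsUnit (1 - z • b11 M))
    (hζ : IsUnit (1 - ζ • b11 M)) :
    charFun M z ∘L adjoint (charFun M ζ) =
      .id ℂ 𝒴 - (1 - z * star ζ) • (obsFun M z ∘L adjoint (obsFun M ζ)) := by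
  have h := row_comp_adjoint_row (obsFun M z) (obsFun M ζ) (charFun M z) (charFun M ζ)
  rw [← row_comp_eq_row_obsFun_charFun hz, ← row_comp_eq_row_obsFun_charFun hζ, adjoint_comp,
    comp_assoc, ← comp_assoc M, hM, id_comp, row_comp_adjoint_row] at h
  simp only [map_smulₛₗ, smul_comp, comp_smul, smul_smul] at h
  rw [← eq_sub_iff_add_eq'] at h
  have hid : adjoint (ContinuousLinearMap.id ℂ 𝒴) = .id ℂ 𝒴 := adjoint_id
  rw [hid, comp_id] at h
  rw [h, sub_smul, one_smul, mul_comm z]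
  change _ = _ - (_ - ((starRingEnd ℂ) ζ * z) • _)
  abel

theorem norm_le_one_of_comp_adjoint_eq {A : 𝒰 →L[ℂ] 𝒴} {B : 𝒳₀ →L[ℂ] 𝒴} {c : ℝ} (hc : 0 ≤ c)
    (h : A ∘L adjoint A = .id ℂ 𝒴 - (c : ℂ) • (B ∘L adjoint B)) : ‖A‖ ≤ 1 := by
  rw [← LinearIsometryEquiv.norm_map adjoint A]
  refine opNorm_le_bound _ zero_le_one fun y ↦ ?_
  have h1 := congrArg (fun L : 𝒴 →L[ℂ] 𝒴 ↦ RCLike.re ⟪y, L y⟫_ℂ) h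
  simp only [coe_comp, Function.comp_apply, sub_apply, smul_apply, id_apply, inner_sub_right,
    inner_smul_right, map_sub, inner_self_eq_norm_sq] at h1
  rw [← adjoint_inner_left A, ← adjoint_inner_left B, inner_self_eq_norm_sq] at h1
  have h2 : RCLike.re ((c : ℂ) * ⟪adjoint B y, adjoint B y⟫_ℂ) = c * ‖adjoint B y‖ ^ 2 := by
    rw [← inner_self_eq_norm_sq (𝕜 := ℂ)]
    exact Complex.re_ofReal_mul _ _
  rw [h2] at h1
  rw [one_mul, ← sq_le_sq₀ (norm_nonneg _) (norm_nonneg _)]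
  nlinarith [sq_nonneg ‖adjoint B y‖, mul_nonneg hc (sq_nonneg ‖adjoint B y‖)]

theorem one_sub_mul_star_self (z : ℂ) : 1 - z * star z = ((1 - ‖z‖ ^ 2 : ℝ) : ℂ) := by
  rw [Complex.star_def, Complex.mul_conj, Complex.normSq_eq_norm_sq]
  push_cast
  rfl

theorem norm_charFun_le (hM : IsCoisometry M) (hz : ‖z‖ < 1) : ‖charFun M z‖ ≤ 1 := by
  have hu := isUnit_one_sub_smul (norm_b11_le hM.norm_le_one) hz
  have h := charFun_comp_adjoint_charFun hM hu hu
  rw [one_sub_mul_star_self] at h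
  exact norm_le_one_of_comp_adjoint_eq (by nlinarith [norm_nonneg z]) h

end Resolvent

/-! ### The Redheffer transform. -/

section Redheffer

variable {𝒳₀ 𝒰 𝒴 Δ Δs : Type*}
  [NormedAddCommGroup 𝒳₀] [InnerProductSpace ℂ 𝒳₀] [CompleteSpace 𝒳₀]
  [NormedAddCommGroup 𝒰] [InnerProductSpace ℂ 𝒰] [CompleteSpace 𝒰]
  [NormedAddCommGroup 𝒴] [InnerProductSpace ℂ 𝒴] [CompleteSpace 𝒴]
  [NormedAddCommGroup Δ] [InnerProductSpace ℂ Δ] [CompleteSpace Δ]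
  [NormedAddCommGroup Δs] [InnerProductSpace ℂ Δs] [CompleteSpace Δs]

theorem redG_comp (Sg : ℂ → DSum 𝒰 Δs →L[ℂ] DSum 𝒴 Δ) (ℰ : ℂ → Δ →L[ℂ] Δs) {z : ℂ}
    (hu : IsUnit (1 - ℰ z ∘L b22 (Sg z))) :
    b12 (Sg z) + redG Sg ℰ z ∘L ℰ z ∘L b22 (Sg z) = redG Sg ℰ z := by
  have h : Ring.inverse (1 - ℰ z ∘L b22 (Sg z)) * (1 - ℰ z ∘L b22 (Sg z)) = 1 :=
    Ring.inverse_mul_cancel _ hu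
  have h2 : redG Sg ℰ z ∘L (1 - ℰ z ∘L b22 (Sg z)) = b12 (Sg z) := by
    rw [redG, comp_assoc]
    exact (congrArg (b12 (Sg z) ∘L ·) h).trans (comp_id _)
  rw [comp_sub] at h2
  conv_lhs => rw [← h2]
  change redG Sg ℰ z ∘L .id ℂ Δs - _ + _ = _
  rw [comp_id]
  abel

/-- The row `[I, Gℰ]` closes the feedback loop through `ℰ`. The same row sends the observability
function of `M` to `Γ`, so identities for `Σ` become identities for `S`, `G` and `Γ`. -/
theorem row_comp_eq_row_redheffer_redG (Sg : ℂ → DSum 𝒰 Δs →L[ℂ] DSum 𝒴 Δ) (ℰ : ℂ → Δ →L[ℂ] Δs)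
    {z : ℂ} (hu : IsUnit (1 - ℰ z ∘L b22 (Sg z))) :
    row (.id ℂ 𝒴) (redG Sg ℰ z ∘L ℰ z) ∘L Sg z = row (redheffer Sg ℰ z) (redG Sg ℰ z) := by
  rw [row_comp_block, id_comp, id_comp, comp_assoc _ _ (b22 (Sg z)), redG_comp Sg ℰ hu]
  rfl

variable {M : DSum 𝒳₀ (DSum 𝒰 Δs) →L[ℂ] DSum 𝒳₀ (DSum 𝒴 Δ)} {ℰ : ℂ → Δ →L[ℂ] Δs} {z ζ : ℂ}

theorem redΓ_eq (M : DSum 𝒳₀ (DSum 𝒰 Δs) →L[ℂ] DSum 𝒳₀ (DSum 𝒴 Δ)) (ℰ : ℂ → Δ →L[ℂ] Δs)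
    (G : ℂ → Δs →L[ℂ] 𝒴) (z : ℂ) :
    redΓ M ℰ G z = row (.id ℂ 𝒴) (G z ∘L ℰ z) ∘L obsFun M z := rfl

/-- The kernel identity `I - S(z) S(ζ)* = G(z) (I - ℰ(z) ℰ(ζ)*) G(ζ)* + (1 - z ζ̄) Γ(z) Γ(ζ)*`
for the Redheffer transform. -/
theorem one_sub_redheffer_comp_adjoint (hM : IsCoisometry M)
    (hz : IsUnit (1 - z • b11 M)) (hζ : IsUnit (1 - ζ • b11 M))
    (hz' : IsUnit (1 - ℰ z ∘L b22 (charFun M z))) (hζ' : IsUnit (1 - ℰ ζ ∘L b22 (charFun M ζ))) :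
    1 - redheffer (charFun M) ℰ z ∘L adjoint (redheffer (charFun M) ℰ ζ) =
      redG (charFun M) ℰ z ∘L (1 - ℰ z ∘L adjoint (ℰ ζ)) ∘L adjoint (redG (charFun M) ℰ ζ) +
      (1 - z * star ζ) • (redΓ M ℰ (redG (charFun M) ℰ) z ∘L
        adjoint (redΓ M ℰ (redG (charFun M) ℰ) ζ)) := by
  set G := redG (charFun M) ℰ
  have h := row_comp_adjoint_row (redheffer (charFun M) ℰ z) (redheffer (charFun M) ℰ ζ)
    (G z) (G ζ)
  rw [← row_comp_eq_row_redheffer_redG _ _ hz', ← row_comp_eq_row_redheffer_redG _ _ hζ',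
    adjoint_comp, comp_assoc, ← comp_assoc (charFun M z), charFun_comp_adjoint_charFun hM hz hζ,
    sub_comp, id_comp, comp_sub, row_comp_adjoint_row, smul_comp, comp_smul, comp_assoc (obsFun M z),
    ← comp_assoc _ (obsFun M z), ← adjoint_comp, ← redΓ_eq, ← redΓ_eq] at h
  have hid : adjoint (ContinuousLinearMap.id ℂ 𝒴) = .id ℂ 𝒴 := adjoint_id
  rw [hid, comp_id, adjoint_comp] at h
  rw [sub_comp, comp_sub]
  change ContinuousLinearMap.id ℂ 𝒴 - _ = G z ∘L (.id ℂ Δs ∘L _) - _ + _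
  rw [id_comp]
  rw [← sub_eq_iff_eq_add] at h
  rw [← h]
  simp only [comp_assoc]
  abel

theorem differentiableOn_b (Sg : ℂ → DSum 𝒰 Δs →L[ℂ] DSum 𝒴 Δ) {s : Set ℂ}
    (h : DifferentiableOn ℂ Sg s) :
    DifferentiableOn ℂ (fun z ↦ b11 (Sg z)) s ∧ DifferentiableOn ℂ (fun z ↦ b12 (Sg z)) s ∧
    DifferentiableOn ℂ (fun z ↦ b21 (Sg z)) s ∧ DifferentiableOn ℂ (fun z ↦ b22 (Sg z)) s := by
  refine ⟨?_, ?_, ?_, ?_⟩ <;>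
  exact (differentiableOn_const _).clm_comp (h.clm_comp (differentiableOn_const _))

/-- Schwarz's lemma: `Σ₂₂` is analytic and contractive, and it vanishes at the origin because the
corner of `D` is zero. -/
theorem norm_b22_charFun_lt (hM : IsCoisometry M) (h0 : b22 (b22 M) = 0) (hz : ‖z‖ < 1) :
    ‖b22 (charFun M z)‖ < 1 := by
  have hd : DifferentiableOn ℂ (fun z ↦ b22 (charFun M z)) (Metric.ball 0 1) :=
    (differentiableOn_b _ (differentiableOn_charFun hM.norm_le_one)).2.2.2
  have hmaps : Set.MapsTo (fun z ↦ b22 (charFun M z)) (Metric.ball 0 1)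
      (Metric.closedBall 0 1) := fun w hw ↦
    mem_closedBall_zero_iff.2 (norm_b22_le (norm_charFun_le hM (mem_ball_zero_iff.1 hw)))
  have h00 : b22 (charFun M 0) = 0 := by rw [charFun_eq, zero_smul, add_zero, h0]
  exact (Complex.norm_le_norm_of_mapsTo_ball (f := fun z ↦ b22 (charFun M z)) hd hmaps h00
    hz).trans_lt hz

theorem isUnit_one_sub_comp_b22 (hM : IsCoisometry M) (h0 : b22 (b22 M) = 0) (hℰ : IsSchur ℰ)
    (hz : ‖z‖ < 1) : IsUnit (1 - ℰ z ∘L b22 (charFun M z)) := by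
  refine isUnit_one_sub_of_norm_lt_one ?_
  have h1 := opNorm_comp_le (ℰ z) (b22 (charFun M z))
  have h2 := hℰ.contractive z (mem_ball_zero_iff.2 hz)
  have h3 := norm_b22_charFun_lt hM h0 hz
  nlinarith [norm_nonneg (ℰ z), norm_nonneg (b22 (charFun M z))]

/-- The Redheffer transform of a Schur class function is a Schur class function. -/
theorem IsSchur.redheffer (hM : IsCoisometry M) (h0 : b22 (b22 M) = 0) (hℰ : IsSchur ℰ) :
    IsSchur (redheffer (charFun M) ℰ) := by
  have hu : ∀ z ∈ Metric.ball (0 : ℂ) 1, IsUnit (1 - ℰ z ∘L b22 (charFun M z)) := fun z hz ↦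
    isUnit_one_sub_comp_b22 hM h0 hℰ (mem_ball_zero_iff.1 hz)
  refine ⟨?_, fun z hz ↦ ?_⟩
  · obtain ⟨h11, h12, h21, h22⟩ := differentiableOn_b _ (differentiableOn_charFun hM.norm_le_one)
    have hinv := differentiableOn_inverse
      ((differentiableOn_const (1 : Δs →L[ℂ] Δs)).fun_sub (hℰ.analytic.clm_comp h22)) hu
    exact h11.add (h12.clm_comp (hinv.clm_comp (hℰ.analytic.clm_comp h21)))
  · have hz1 : ‖z‖ < 1 := mem_ball_zero_iff.1 hz
    have hA := isUnit_one_sub_smul (norm_b11_le hM.norm_le_one) hz1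
    have h := one_sub_redheffer_comp_adjoint hM hA hA (hu z hz) (hu z hz)
    set S := BR.redheffer (charFun M) ℰ
    set G := redG (charFun M) ℰ
    set Γ := redΓ M ℰ G
    rw [← LinearIsometryEquiv.norm_map adjoint (S z)]
    refine opNorm_le_bound _ zero_le_one fun y ↦ ?_
    -- On the diagonal the identity reads `‖y‖² - ‖S*y‖² = ‖G*y‖² - ‖ℰ*G*y‖² + (1 - |z|²)‖Γ*y‖²`.
    have h1 := congrArg (fun L : 𝒴 →L[ℂ] 𝒴 ↦ RCLike.re ⟪y, L y⟫_ℂ) h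
    simp only [coe_comp, Function.comp_apply, sub_apply, smul_apply, one_apply_eq_self, add_apply,
      inner_sub_right, inner_add_right, map_sub, map_add, inner_smul_right,
      inner_self_eq_norm_sq, one_sub_mul_star_self] at h1
    rw [← adjoint_inner_left (S z), ← adjoint_inner_left (G z), ← adjoint_inner_left (G z),
      ← adjoint_inner_left (ℰ z), ← adjoint_inner_left (Γ z)] at h1
    have h2 : RCLike.re (((1 - ‖z‖ ^ 2 : ℝ) : ℂ) * ⟪adjoint (Γ z) y, adjoint (Γ z) y⟫_ℂ) =
        (1 - ‖z‖ ^ 2) * ‖adjoint (Γ z) y‖ ^ 2 := by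
      rw [← inner_self_eq_norm_sq (𝕜 := ℂ) (adjoint (Γ z) y)]
      exact Complex.re_ofReal_mul _ _
    rw [h2] at h1
    simp only [inner_self_eq_norm_sq] at h1
    have h3 : ‖adjoint (ℰ z) (adjoint (G z) y)‖ ≤ ‖adjoint (G z) y‖ := by
      have := (adjoint (ℰ z)).le_of_opNorm_le
        ((LinearIsometryEquiv.norm_map adjoint (ℰ z)).trans_le (hℰ.contractive z hz))
        (adjoint (G z) y)
      simpa using this
    have h4 : 0 ≤ (1 - ‖z‖ ^ 2) * ‖adjoint (Γ z) y‖ ^ 2 :=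
      mul_nonneg (by nlinarith [norm_nonneg z]) (sq_nonneg _)
    have h5 := pow_le_pow_left₀ (norm_nonneg _) h3 2
    rw [one_mul, ← sq_le_sq₀ (norm_nonneg _) (norm_nonneg _)]
    linarith

end Redheffer

/-! ### The colligation built from the data. -/

section Colligation

variable {𝒳 𝒰 𝒴 Δ Δs : Type*}
  [NormedAddCommGroup 𝒳] [InnerProductSpace ℂ 𝒳] [CompleteSpace 𝒳]
  [NormedAddCommGroup 𝒰] [InnerProductSpace ℂ 𝒰] [CompleteSpace 𝒰]
  [NormedAddCommGroup 𝒴] [InnerProductSpace ℂ 𝒴] [CompleteSpace 𝒴]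
  [NormedAddCommGroup Δ] [InnerProductSpace ℂ Δ] [CompleteSpace Δ]
  [NormedAddCommGroup Δs] [InnerProductSpace ℂ Δs] [CompleteSpace Δs]
  {P T : 𝒳 →L[ℂ] 𝒳} {E : 𝒳 →L[ℂ] 𝒴} {N : 𝒳 →L[ℂ] 𝒰}

theorem IsAdmissible.isoV_mem_ranV (hD : IsAdmissible P T E N) (d : domV P N) :
    isoV P T E N d ∈ ranV P T E := by
  refine (denseRange_toDomV P N).induction_on (p := fun d ↦ isoV P T E N d ∈ ranV P T E) d
    ((Submodule.isClosed_topologicalClosure _).preimage (isoV P T E N).continuous) fun x ↦ ?_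
  have h : isoV P T E N (toDomV P N x) = col (sqrtP P ∘L T) E x := hD.isoV_toDomV x
  exact h ▸ Submodule.le_topologicalClosure _ (LinearMap.mem_range_self _ x)

/-- An isometry on a complete space has closed range, so containing the generating vectors is
enough. -/
theorem IsAdmissible.range_isoV (hD : IsAdmissible P T E N) :
    Set.range (isoV P T E N) = ranV P T E := by
  refine subset_antisymm ?_ ?_
  · rintro _ ⟨d, rfl⟩
    exact hD.isoV_mem_ranV d
  · have hiso : Isometry (isoV P T E N) :=
      AddMonoidHomClass.isometry_of_norm _ hD.norm_isoV
    refine closure_minimal ?_ hiso.isClosedEmbedding.isClosed_range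
    rintro _ ⟨x, rfl⟩
    exact ⟨toDomV P N x, hD.isoV_toDomV x⟩

variable (P T E N) in
theorem colligation_apply (i : defect P N ≃ₗᵢ[ℂ] Δ) (is : defectStar P T E ≃ₗᵢ[ℂ] Δs)
    (x : DSum (X0 P) (DSum 𝒰 Δs)) :
    colligation P T E N i is x =
      WithLp.toLp 2
        ((isoV P T E N ((domV P N).orthogonalProjectionOnto (WithLp.toLp 2 (x.fst, x.snd.fst))) +
          is.symm x.snd.snd).fst,
        WithLp.toLp 2
          ((isoV P T E N ((domV P N).orthogonalProjectionOnto (WithLp.toLp 2 (x.fst, x.snd.fst))) +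
            is.symm x.snd.snd).snd,
          i ((defect P N).orthogonalProjectionOnto (WithLp.toLp 2 (x.fst, x.snd.fst))))) := rfl

/-- Norms are preserved by Pythagoras in `𝒟_V ⊕ Δ` and `ℛ_V ⊕ Δ_*`; a preimage is found by splitting
the target along `ℛ_V ⊕ Δ_*` and inverting each piece. -/
theorem IsAdmissible.isCoisometry_colligation (hD : IsAdmissible P T E N)
    (i : defect P N ≃ₗᵢ[ℂ] Δ) (is : defectStar P T E ≃ₗᵢ[ℂ] Δs) :
    IsCoisometry (colligation P T E N i is) := by
  refine isCoisometry_of_norm_map_of_surjective (fun x ↦ ?_) fun y ↦ ?_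
  · rw [colligation_apply]
    set p : DSum (X0 P) 𝒰 := WithLp.toLp 2 (x.fst, x.snd.fst) with hp
    set v := isoV P T E N ((domV P N).orthogonalProjectionOnto p)
    set w : DSum (X0 P) 𝒴 := ((is.symm x.snd.snd : defectStar P T E) : DSum (X0 P) 𝒴)
    have h1 : ‖v + w‖ ^ 2 = ‖v‖ ^ 2 + ‖w‖ ^ 2 := by
      have hv : v ∈ ranV P T E := hD.isoV_mem_ranV _
      have h0 : ⟪v, w⟫_ℂ = 0 :=
        Submodule.inner_right_of_mem_orthogonal hv (is.symm x.snd.snd).2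
      have := norm_add_sq_eq_norm_sq_add_norm_sq_of_inner_eq_zero v w h0
      simpa only [sq] using this
    have h2 : ‖v‖ = ‖(domV P N).orthogonalProjectionOnto p‖ := hD.norm_isoV _
    have h3 : ‖w‖ = ‖x.snd.snd‖ := is.symm.norm_map _
    have h4 := Submodule.norm_sq_eq_add_norm_sq_projection p (domV P N)
    have h5 := i.norm_map ((defect P N).orthogonalProjectionOnto p)
    rw [← sq_eq_sq₀ (norm_nonneg _) (norm_nonneg _)]
    rw [WithLp.prod_norm_sq_eq_of_L2] at h1 h4 ⊢
    rw [WithLp.prod_norm_sq_eq_of_L2 (WithLp.snd _), WithLp.prod_norm_sq_eq_of_L2 x,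
      WithLp.prod_norm_sq_eq_of_L2 x.snd]
    simp only [WithLp.toLp_fst, WithLp.toLp_snd] at h4 ⊢
    rw [h2, h3] at h1
    rw [h5]
    have h6 : ‖p.fst‖ = ‖x.fst‖ := rfl
    have h7 : ‖p.snd‖ = ‖x.snd.fst‖ := rfl
    rw [h6, h7] at h4
    linarith
  · set w : DSum (X0 P) 𝒴 := WithLp.toLp 2 (y.fst, y.snd.fst) with hw
    obtain ⟨q, hq⟩ : ((ranV P T E).orthogonalProjectionOnto w : DSum (X0 P) 𝒴) ∈
        Set.range (isoV P T E N) := hD.range_isoV ▸ Subtype.mem _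
    set p : DSum (X0 P) 𝒰 := q + (i.symm y.snd.snd : defect P N) with hp
    refine ⟨WithLp.toLp 2 (p.fst, WithLp.toLp 2 (p.snd,
      is ((defectStar P T E).orthogonalProjectionOnto w))), ?_⟩
    rw [colligation_apply]
    have e1 : (domV P N).orthogonalProjectionOnto p = q := by
      rw [hp, map_add, Submodule.orthogonalProjectionOnto_mem_subspace_eq_self,
        Submodule.orthogonalProjectionOnto_apply_of_mem_orthogonal
          (i.symm y.snd.snd).2, add_zero]
    have e2 : (defect P N).orthogonalProjectionOnto p = i.symm y.snd.snd := by
      rw [hp, map_add, Submodule.orthogonalProjectionOnto_mem_subspace_eq_self,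
        Submodule.orthogonalProjectionOnto_orthogonal_apply_eq_zero q.2, zero_add]
    change WithLp.toLp 2 ((isoV P T E N ((domV P N).orthogonalProjectionOnto p) +
        (is.symm (is ((defectStar P T E).orthogonalProjectionOnto w)) : defectStar P T E)).fst,
        WithLp.toLp 2 ((isoV P T E N ((domV P N).orthogonalProjectionOnto p) +
        (is.symm (is ((defectStar P T E).orthogonalProjectionOnto w)) : defectStar P T E)).snd,
        i ((defect P N).orthogonalProjectionOnto p))) = y
    rw [e1, e2, hq, is.symm_apply_apply, i.apply_symm_apply]
    have e3 : ((ranV P T E).orthogonalProjectionOnto w : DSum (X0 P) 𝒴) +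
        ((defectStar P T E).orthogonalProjectionOnto w : DSum (X0 P) 𝒴) = w :=
      Submodule.starProjection_add_starProjection_orthogonal w
    rw [e3]
    rfl

theorem b22_b22_colligation (i : defect P N ≃ₗᵢ[ℂ] Δ) (is : defectStar P T E ≃ₗᵢ[ℂ] Δs)
    {M : DSum (X0 P) (DSum 𝒰 Δs) →L[ℂ] DSum (X0 P) (DSum 𝒴 Δ)}
    (hM : M = colligation P T E N i is) : b22 (b22 M) = 0 := by
  ext d
  change (M (WithLp.toLp 2 (0, WithLp.toLp 2 (0, d)))).snd.snd = 0
  rw [hM, colligation_apply]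
  have h0 : (WithLp.toLp 2 (0, 0) : DSum (X0 P) 𝒰) = 0 := rfl
  simp only [WithLp.toLp_fst, WithLp.toLp_snd, h0, map_zero]

/-- One time step of the trajectory generated by `x`: on `𝒟_V` the colligation is `V`, and the
channels `Δ̃_*` and `Δ̃` stay silent. -/
theorem IsAdmissible.colligation_sqrtP (hD : IsAdmissible P T E N)
    (i : defect P N ≃ₗᵢ[ℂ] Δ) (is : defectStar P T E ≃ₗᵢ[ℂ] Δs) (x : 𝒳) :
    colligation P T E N i is (WithLp.toLp 2 (sqrtP P x, WithLp.toLp 2 (N x, 0))) =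
      WithLp.toLp 2 (sqrtP P (T x), WithLp.toLp 2 (E x, 0)) := by
  rw [colligation_apply]
  have h0 : WithLp.toLp 2 (sqrtP P x, N x) = (toDomV P N x : DSum (X0 P) 𝒰) := rfl
  have h1 : (domV P N).orthogonalProjectionOnto (WithLp.toLp 2 (sqrtP P x, N x)) =
      toDomV P N x := by
    rw [h0, Submodule.orthogonalProjectionOnto_mem_subspace_eq_self]
  have h2 : (defect P N).orthogonalProjectionOnto (WithLp.toLp 2 (sqrtP P x, N x)) = 0 := by
    rw [h0, Submodule.orthogonalProjectionOnto_orthogonal_apply_eq_zero (toDomV P N x).2]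
  have h3 : isoV P T E N (toDomV P N x) = col (sqrtP P ∘L T) E x := hD.isoV_toDomV x
  simp only [WithLp.toLp_fst, WithLp.toLp_snd, h1, h2, h3, map_zero, Submodule.coe_zero, add_zero]
  rfl

end Colligation

/-! ### Trajectories of contractive systems and their generating functions. -/

section StateSpace

open Filter Topology

/-- A sequence growing no faster than the sum of an input of radius of convergence `≥ 1` has itself
radius of convergence `≥ 1`. -/
theorem tendsto_pow_mul_of_le_add {a b : ℕ → ℝ} (ha : ∀ n, 0 ≤ a n)
    (hab : ∀ n, a (n + 1) ≤ a n + b n)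
    (hb : ∀ r : ℝ, 0 < r → r < 1 → ∃ c, ∀ n, r ^ n * b n ≤ c) {t : ℝ} (ht : 0 ≤ t) (ht1 : t < 1) :
    Tendsto (fun n ↦ t ^ n * a n) atTop (𝓝 0) := by
  obtain ⟨r, htr, hr1⟩ := exists_between ht1
  have hr : 0 < r := ht.trans_lt htr
  obtain ⟨c', hc'⟩ := hb r hr hr1
  set c := max c' 0
  have hc : ∀ n, r ^ n * b n ≤ c := fun n ↦ (hc' n).trans (le_max_left _ _)
  have hc0 : 0 ≤ c := le_max_right _ _
  have h1r : 0 < 1 - r := by linarith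
  -- `K` is chosen so that `r(K + c) ≤ K`, which makes `rⁿ aₙ ≤ K` inductive; the room `t < r` then
  -- supplies the decay `(t/r)ⁿ`.
  set K := a 0 + c / (1 - r) with hK
  have hcK : c / (1 - r) * (1 - r) = c := div_mul_cancel₀ _ h1r.ne'
  have hd : 0 ≤ c / (1 - r) := by positivity
  have hbound : ∀ n, r ^ n * a n ≤ K := by
    intro n
    induction n with
    | zero => simpa [hK] using hd
    | succ n ih =>
      have h1 : r ^ (n + 1) * a (n + 1) ≤ r * (r ^ n * a n + r ^ n * b n) := by
        have := mul_le_mul_of_nonneg_left (hab n) (pow_pos hr (n + 1)).le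
        calc _ ≤ _ := this
          _ = _ := by ring
      have h2 : r * (r ^ n * a n + r ^ n * b n) ≤ r * (K + c) :=
        mul_le_mul_of_nonneg_left (add_le_add ih (hc n)) hr.le
      have h3 : K * (1 - r) = a 0 * (1 - r) + c := by rw [hK, add_mul, hcK]
      nlinarith [mul_nonneg (ha 0) h1r.le, mul_nonneg hc0 h1r.le]
  have hlim : Tendsto (fun n ↦ (t / r) ^ n * K) atTop (𝓝 0) := by
    simpa using (tendsto_pow_atTop_nhds_zero_of_lt_one (div_nonneg ht hr.le)
      ((div_lt_one hr).2 htr)).mul_const K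
  refine squeeze_zero (fun n ↦ mul_nonneg (pow_nonneg ht n) (ha n)) (fun n ↦ ?_) hlim
  have : t ^ n * a n = (t / r) ^ n * (r ^ n * a n) := by
    rw [div_pow, ← mul_assoc, div_mul_cancel₀ _ (pow_pos hr n).ne']
  rw [this]
  exact mul_le_mul_of_nonneg_left (hbound n) (pow_nonneg (div_nonneg ht hr.le) n)

variable {𝒳₀ 𝒰 𝒴 : Type*}
  [NormedAddCommGroup 𝒳₀] [InnerProductSpace ℂ 𝒳₀] [CompleteSpace 𝒳₀]
  [NormedAddCommGroup 𝒰] [InnerProductSpace ℂ 𝒰] [CompleteSpace 𝒰]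
  [NormedAddCommGroup 𝒴] [InnerProductSpace ℂ 𝒴] [CompleteSpace 𝒴]

/-- The input-output relation `ŷ = C (I - zA)⁻¹ p₀ + (D + z C (I - zA)⁻¹ B) û` of a contractive
linear system, for inputs whose power series converges on the disk. -/
theorem tendsto_sum_output {M : DSum 𝒳₀ 𝒰 →L[ℂ] DSum 𝒳₀ 𝒴} (hM : ‖M‖ ≤ 1)
    {p : ℕ → 𝒳₀} {u : ℕ → 𝒰} {y : ℕ → 𝒴}
    (hsys : ∀ n, M (WithLp.toLp 2 (p n, u n)) = WithLp.toLp 2 (p (n + 1), y n))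
    (hu : ∀ z ∈ Metric.ball (0 : ℂ) 1, Summable fun n ↦ z ^ n • u n) {z : ℂ} (hz : ‖z‖ < 1) :
    Tendsto (fun m ↦ ∑ n ∈ Finset.range m, z ^ n • y n) atTop
      (𝓝 (obsFun M z (p 0) + charFun M z (∑' n, z ^ n • u n))) := by
  have hp : ∀ n, p (n + 1) = b11 M (p n) + b12 M (u n) := fun n ↦ by
    have := fst_apply_block M (WithLp.toLp 2 (p n, u n))
    rwa [hsys] at this
  have hy : ∀ n, y n = b21 M (p n) + b22 M (u n) := fun n ↦ by
    have := snd_apply_block M (WithLp.toLp 2 (p n, u n))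
    rwa [hsys] at this
  have hpn : ∀ n, ‖p (n + 1)‖ ≤ ‖p n‖ + ‖u n‖ := fun n ↦ by
    have h1 := M.le_of_opNorm_le hM (WithLp.toLp 2 (p n, u n))
    have h2 := WithLp.norm_fst_le 𝒳₀ (M (WithLp.toLp 2 (p n, u n)))
    rw [hsys] at h1 h2
    have h3 : ‖(WithLp.toLp 2 (p n, u n) : DSum 𝒳₀ 𝒰)‖ ≤ ‖p n‖ + ‖u n‖ := by
      rw [← toLp_fst_add_snd (WithLp.toLp 2 (p n, u n))]
      exact (norm_add_le _ _).trans_eq (by simp)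
    simp only [WithLp.toLp_fst] at h2
    linarith
  have hlim : Tendsto (fun n ↦ z ^ n • p n) atTop (𝓝 0) := by
    rw [tendsto_zero_iff_norm_tendsto_zero]
    simp only [norm_smul, norm_pow]
    refine tendsto_pow_mul_of_le_add (fun n ↦ norm_nonneg _) hpn (fun r hr hr1 ↦ ?_)
      (norm_nonneg z) hz
    have hs := hu r (by simpa [abs_of_pos hr] using hr1)
    obtain ⟨c, hc⟩ := (hs.tendsto_atTop_zero.norm).bddAbove_range
    refine ⟨c, fun n ↦ ?_⟩
    have := hc (Set.mem_range_self n)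
    simpa [norm_smul, abs_of_pos hr] using this
  have hU : Tendsto (fun m ↦ ∑ n ∈ Finset.range m, z ^ n • u n) atTop (𝓝 (∑' n, z ^ n • u n)) :=
    (hu z (mem_ball_zero_iff.2 hz)).hasSum.tendsto_sum_nat
  have hA := isUnit_one_sub_smul (norm_b11_le hM) hz
  set R := Ring.inverse (1 - z • b11 M) with hR
  have hRc : ∀ v, R ((1 - z • b11 M) v) = v := fun v ↦
    congrArg (fun L : 𝒳₀ →L[ℂ] 𝒳₀ ↦ L v) (Ring.inverse_mul_cancel _ hA)
  -- The state recursion telescopes, so only the boundary term `z^m p m` has to vanish in the limit.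
  have hstate : ∀ m, (1 - z • b11 M) (∑ n ∈ Finset.range m, z ^ n • p n) =
      p 0 - z ^ m • p m + z • b12 M (∑ n ∈ Finset.range m, z ^ n • u n) := by
    intro m
    induction m with
    | zero => simp
    | succ m ih =>
      rw [Finset.sum_range_succ, Finset.sum_range_succ, map_add, ih, hp]
      simp only [sub_apply, one_apply_eq_self, smul_apply, map_smul, map_add]
      module
  have hsum : ∀ m, ∑ n ∈ Finset.range m, z ^ n • y n =
      b21 M (R (p 0 - z ^ m • p m + z • b12 M (∑ n ∈ Finset.range m, z ^ n • u n))) +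
        b22 M (∑ n ∈ Finset.range m, z ^ n • u n) := by
    intro m
    rw [← hstate, hRc]
    simp only [map_sum, hy, smul_add, Finset.sum_add_distrib, map_smul]
  simp only [hsum]
  have hval : obsFun M z (p 0) + charFun M z (∑' n, z ^ n • u n) =
      b21 M (R (p 0 - 0 + z • b12 M (∑' n, z ^ n • u n))) + b22 M (∑' n, z ^ n • u n) := by
    rw [charFun_eq]
    simp only [obsFun, ← hR, add_apply, smul_apply, coe_comp, Function.comp_apply, map_add,
      map_smul, sub_zero]
    abel
  rw [hval]
  refine Tendsto.add ?_ (((b22 M).continuous.tendsto _).comp hU)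
  refine ((b21 M ∘L R).continuous.tendsto _).comp ?_
  exact (tendsto_const_nhds.sub hlim).add ((((b12 M).continuous.tendsto _).comp hU).const_smul z)

/-- Where `I - zT` is invertible, the power series `obs E T x z` is `E (I - zT)⁻¹ x`. -/
theorem obs_eq_inverse {T : 𝒳₀ →L[ℂ] 𝒳₀} {E : 𝒳₀ →L[ℂ] 𝒴} (h : IsAnalyticOutputPair E T) {z : ℂ}
    (hz : ‖z‖ < 1) (hu : IsUnit (1 - z • T)) (x : 𝒳₀) :
    obs E T x z = E (Ring.inverse (1 - z • T) x) := by
  set w := Ring.inverse (1 - z • T) x with hw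
  have hx : x = w - z • T w :=
    (congrArg (fun L : 𝒳₀ →L[ℂ] 𝒳₀ ↦ L x) (Ring.mul_inverse_cancel _ hu)).symm
  have hs := h w z (mem_ball_zero_iff.2 hz)
  have hsx := h x z (mem_ball_zero_iff.2 hz)
  refine tendsto_nhds_unique hsx.hasSum.tendsto_sum_nat ?_
  -- Substituting `x = w - zTw` telescopes the series. The Neumann series of `T` itself may diverge
  -- here; only the terms for `w` after applying `E` must tend to zero.
  have hpart : ∀ m, ∑ n ∈ Finset.range m, z ^ n • E ((T ^ n) x) = E w - z ^ m • E ((T ^ m) w) := by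
    intro m
    induction m with
    | zero => simp
    | succ m ih =>
      rw [Finset.sum_range_succ, ih, hx]
      have : (T ^ m) (T w) = (T ^ (m + 1)) w := by rw [pow_succ]; rfl
      simp only [map_sub, map_smul, this, smul_sub, smul_smul, ← pow_succ]
      abel
  simp only [hpart]
  simpa using tendsto_const_nhds.sub hs.tendsto_atTop_zero

end StateSpace

/-! ### The identity `F^S = ΓP^{1/2}`. -/

section Data

variable {𝒳 𝒰 𝒴 Δ Δs : Type*}
  [NormedAddCommGroup 𝒳] [InnerProductSpace ℂ 𝒳] [CompleteSpace 𝒳]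
  [NormedAddCommGroup 𝒰] [InnerProductSpace ℂ 𝒰] [CompleteSpace 𝒰]
  [NormedAddCommGroup 𝒴] [InnerProductSpace ℂ 𝒴] [CompleteSpace 𝒴]
  [NormedAddCommGroup Δ] [InnerProductSpace ℂ Δ] [CompleteSpace Δ]
  [NormedAddCommGroup Δs] [InnerProductSpace ℂ Δs] [CompleteSpace Δs]
  {P T : 𝒳 →L[ℂ] 𝒳} {E : 𝒳 →L[ℂ] 𝒴} {N : 𝒳 →L[ℂ] 𝒰}

theorem IsAdmissible.FS_eq (hD : IsAdmissible P T E N)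
    (i : defect P N ≃ₗᵢ[ℂ] Δ) (is : defectStar P T E ≃ₗᵢ[ℂ] Δs) (ℰ : ℂ → Δ →L[ℂ] Δs)
    {M : DSum (X0 P) (DSum 𝒰 Δs) →L[ℂ] DSum (X0 P) (DSum 𝒴 Δ)}
    (hM : M = colligation P T E N i is) {z : ℂ} (hz : ‖z‖ < 1)
    (hu : IsUnit (1 - ℰ z ∘L b22 (charFun M z))) (x : 𝒳) :
    FS T E N (redheffer (charFun M) ℰ) z x =
      redΓ M ℰ (redG (charFun M) ℰ) z (sqrtP P x) := by
  have hM1 : ‖M‖ ≤ 1 := hM ▸ (hD.isCoisometry_colligation i is).norm_le_one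
  have hsys : ∀ n : ℕ, M (WithLp.toLp 2 (sqrtP P ((T ^ n) x), col (.id ℂ 𝒰) 0 (N ((T ^ n) x)))) =
      WithLp.toLp 2 (sqrtP P ((T ^ (n + 1)) x), col (.id ℂ 𝒴) 0 (E ((T ^ n) x))) := fun n ↦ by
    have := hD.colligation_sqrtP i is ((T ^ n) x)
    rw [← hM] at this
    rw [pow_succ']
    exact this
  have hsumN : ∀ ζ ∈ Metric.ball (0 : ℂ) 1, Summable fun n : ℕ ↦
      ζ ^ n • (col (.id ℂ 𝒰) 0 (N ((T ^ n) x)) : DSum 𝒰 Δs) := fun ζ hζ ↦ by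
    simpa only [map_smul] using (hD.output_N x ζ hζ).mapL (col (.id ℂ 𝒰) (0 : 𝒰 →L[ℂ] Δs))
  have hlim := tendsto_sum_output hM1 hsys hsumN hz
  have hz' := mem_ball_zero_iff.2 hz
  have hN : ∑' n : ℕ, z ^ n • (col (.id ℂ 𝒰) 0 (N ((T ^ n) x)) : DSum 𝒰 Δs) =
      col (.id ℂ 𝒰) 0 (obs N T x z) := by
    rw [obs, (col (.id ℂ 𝒰) (0 : 𝒰 →L[ℂ] Δs)).map_tsum (hD.output_N x z hz')]
    simp only [map_smul]
  have hE : Filter.Tendsto (fun m ↦ ∑ n ∈ Finset.range m,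
      z ^ n • (col (.id ℂ 𝒴) 0 (E ((T ^ n) x)) : DSum 𝒴 Δ)) Filter.atTop
      (nhds (col (.id ℂ 𝒴) 0 (obs E T x z))) := by
    have := ((col (.id ℂ 𝒴) (0 : 𝒴 →L[ℂ] Δ)).continuous.tendsto _).comp
      (hD.output_E x z hz').hasSum.tendsto_sum_nat
    simpa only [Function.comp_def, map_sum, map_smul, obs] using this
  have key := tendsto_nhds_unique hE hlim
  rw [hN] at key
  -- `key` says `(Ê, 0) = C(I - zA)⁻¹P^{1/2}x + Σ(z)(N̂, 0)`, where `Ê` and `N̂` are the two power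
  -- series. The row `[I, Gℰ]` turns it into `Ê = Γ(z)P^{1/2}x + S(z)N̂`.
  have h2 := congrArg (row (.id ℂ 𝒴) (redG (charFun M) ℰ z ∘L ℰ z)) key
  rw [map_add, ← comp_apply _ (charFun M z), row_comp_eq_row_redheffer_redG _ _ hu,
    ← comp_apply _ (obsFun M z), ← redΓ_eq] at h2
  simp only [row_apply, col_apply, WithLp.toLp_fst, WithLp.toLp_snd, id_apply, zero_apply,
    map_zero, add_zero, pow_zero, one_apply_eq_self] at h2
  rw [FS, h2, add_sub_cancel_right]

end Data

/-! ### Coisometric rows with an isometric entry. -/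

section PartialIsometry

variable {H K L : Type*}
  [NormedAddCommGroup H] [InnerProductSpace ℂ H] [CompleteSpace H]
  [NormedAddCommGroup K] [InnerProductSpace ℂ K] [CompleteSpace K]
  [NormedAddCommGroup L] [InnerProductSpace ℂ L] [CompleteSpace L]

/-- `(ker A)ᗮ` is the closure of the range of `A*`, and both norms are continuous. -/
theorem IsPartialIsometry.of_norm_map_adjoint {A : H →L[ℂ] K}
    (h : ∀ y, ‖A (adjoint A y)‖ = ‖adjoint A y‖) : IsPartialIsometry A := by
  intro x hx
  rw [orthogonal_ker] at hx
  refine closure_minimal (t := {x | ‖A x‖ = ‖x‖}) ?_ (isClosed_eq (by fun_prop) (by fun_prop)) hx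
  rintro _ ⟨y, rfl⟩
  exact h y

/-- If `[A B]` is a coisometry and `B` is an isometry, then `A` is a partial isometry. -/
theorem IsCoisometry.isPartialIsometry_left {A : H →L[ℂ] K} {B : L →L[ℂ] K}
    (h : IsCoisometry (row A B)) (hB : Isometry B) : IsPartialIsometry A := by
  rw [IsCoisometry, row_comp_adjoint_row] at h
  have hBB : adjoint B ∘L B = 1 := (norm_map_iff_adjoint_comp_self B).1
    fun x ↦ hB.norm_map_of_map_zero (map_zero B) x
  refine .of_norm_map_adjoint fun y ↦ ?_
  -- `A A* = I - B B*` is the projection onto the kernel of `B*`, hence `‖A A* y‖² = ⟪A A* y, y⟫ =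
  -- ‖A* y‖²`.
  have hA : A (adjoint A y) = y - B (adjoint B y) :=
    eq_sub_of_add_eq (congrArg (fun W : K →L[ℂ] K ↦ W y) h)
  have h0 : adjoint B (A (adjoint A y)) = 0 := by
    have h1 : adjoint B (B (adjoint B y)) = adjoint B y :=
      congrArg (fun W : L →L[ℂ] L ↦ W (adjoint B y)) hBB
    rw [hA, map_sub, h1, sub_self]
  have h2 : ⟪A (adjoint A y), A (adjoint A y)⟫_ℂ = ⟪adjoint A y, adjoint A y⟫_ℂ := by
    conv_lhs => rw [hA, inner_sub_left, ← adjoint_inner_right B, ← hA, h0, inner_zero_right,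
      sub_zero, ← adjoint_inner_left]
  rw [@norm_eq_sqrt_re_inner ℂ, h2, ← @norm_eq_sqrt_re_inner ℂ]

end PartialIsometry

/-! ### The square root of `P` and isometry criteria on `𝒳₀`. -/

section SquareRoot

variable {𝒳 K : Type*}
  [NormedAddCommGroup 𝒳] [InnerProductSpace ℂ 𝒳] [CompleteSpace 𝒳]
  [NormedAddCommGroup K] [InnerProductSpace ℂ K] [CompleteSpace K] {P : 𝒳 →L[ℂ] 𝒳}

theorem inner_sqrtP (hP : P.IsPositive) (x y : 𝒳) :
    ⟪sqrtP P x, sqrtP P y⟫_ℂ = ⟪P x, y⟫_ℂ := by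
  have h0 : (0 : 𝒳 →L[ℂ] 𝒳) ≤ P := (nonneg_iff_isPositive P).2 hP
  have hsq : CFC.sqrt P * CFC.sqrt P = P := CFC.sqrt_mul_sqrt_self P h0
  have hsa : IsSelfAdjoint (CFC.sqrt P) := (CFC.sqrt_nonneg P).isSelfAdjoint
  have h1 : ⟪sqrtP P x, sqrtP P y⟫_ℂ = ⟪CFC.sqrt P x, CFC.sqrt P y⟫_ℂ := rfl
  rw [h1, ← adjoint_inner_left, hsa.adjoint_eq]
  conv_rhs => rw [← hsq]
  rfl

theorem apply_mem_X0 (hP : P.IsPositive) (x : 𝒳) : P x ∈ X0 P := by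
  have h0 : (0 : 𝒳 →L[ℂ] 𝒳) ≤ P := (nonneg_iff_isPositive P).2 hP
  have hsq : CFC.sqrt P * CFC.sqrt P = P := CFC.sqrt_mul_sqrt_self P h0
  have h1 : P x = sqrtP P (CFC.sqrt P x) :=
    congrArg (fun A : 𝒳 →L[ℂ] 𝒳 ↦ A x) hsq.symm
  exact h1 ▸ Subtype.mem _

theorem denseRange_sqrtP (P : 𝒳 →L[ℂ] 𝒳) : DenseRange (sqrtP P) := by
  rw [DenseRange, Subtype.dense_iff]
  rintro y hy
  refine closure_mono ?_ hy
  rintro _ ⟨x, rfl⟩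
  exact ⟨sqrtP P x, ⟨x, rfl⟩, rfl⟩

/-- `P^{1/2}` kills the orthogonal complement of `𝒳₀`, since `‖P^{1/2}w‖² = ⟪Pw, w⟫` and `Pw ∈ 𝒳₀`.
So the restriction to `𝒳₀` still has dense range. -/
theorem range_sqrtP_comp_subtypeL (hP : P.IsPositive) :
    Set.range (sqrtP P ∘L (X0 P).subtypeL) = Set.range (sqrtP P) := by
  refine subset_antisymm ?_ ?_
  · rintro _ ⟨x, rfl⟩
    exact ⟨x, rfl⟩
  · rintro _ ⟨x, rfl⟩
    obtain ⟨y, hy, w, hw, rfl⟩ := (X0 P).exists_add_mem_mem_orthogonal x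
    have h0 : sqrtP P w = 0 := by
      rw [← inner_self_eq_zero (𝕜 := ℂ), inner_sqrtP hP]
      exact hw _ (apply_mem_X0 hP w)
    exact ⟨⟨y, hy⟩, by rw [map_add, h0, add_zero]; rfl⟩

theorem isometry_of_norm_map_of_denseRange {H L : Type*} [NormedAddCommGroup H]
    [InnerProductSpace ℂ H] {B : H →L[ℂ] K} {f : L → H} (hf : DenseRange f)
    (h : ∀ x, ‖B (f x)‖ = ‖f x‖) : Isometry B :=
  AddMonoidHomClass.isometry_of_norm B fun y ↦
    hf.induction_on (p := fun y ↦ ‖B y‖ = ‖y‖) y (isClosed_eq (by fun_prop) (by fun_prop)) h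

theorem inner_map_map_of_isometry {H : Type*} [NormedAddCommGroup H] [InnerProductSpace ℂ H]
    {B : H →L[ℂ] K} (hB : Isometry B) (x y : H) : ⟪B x, B y⟫_ℂ = ⟪x, y⟫_ℂ :=
  LinearIsometry.inner_map_map
    ⟨(B : H →ₗ[ℂ] K), fun x ↦ hB.norm_map_of_map_zero (map_zero B) x⟩ x y

theorem isometry_iff_eq_adjoint_comp (hP : P.IsPositive) (B : X0 P →L[ℂ] K) :
    Isometry B ↔ P = adjoint (B ∘L sqrtP P) ∘L (B ∘L sqrtP P) := by
  refine ⟨fun hB ↦ ?_, fun h ↦ ?_⟩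
  · ext x
    refine ext_inner_right ℂ fun y ↦ ?_
    rw [coe_comp, Function.comp_apply, adjoint_inner_left, ← inner_sqrtP hP]
    exact (inner_map_map_of_isometry hB _ _).symm
  · refine isometry_of_norm_map_of_denseRange (denseRange_sqrtP P) fun x ↦ ?_
    have h1 : ⟪P x, x⟫_ℂ = ⟪B (sqrtP P x), B (sqrtP P x)⟫_ℂ :=
      (congrArg (fun A : 𝒳 →L[ℂ] 𝒳 ↦ ⟪A x, x⟫_ℂ) h).trans
        (adjoint_inner_left (B ∘L sqrtP P) x _)
    rw [@norm_eq_sqrt_re_inner ℂ, ← h1, ← inner_sqrtP hP, ← @norm_eq_sqrt_re_inner ℂ]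

theorem isometry_iff_forall_eq_adjoint_apply (hP : P.IsPositive) (B : X0 P →L[ℂ] K) :
    Isometry B ↔ ∀ x : X0 P, P x = adjoint (B ∘L sqrtP P ∘L (X0 P).subtypeL)
      ((B ∘L sqrtP P ∘L (X0 P).subtypeL) x) := by
  refine ⟨fun hB x ↦ ?_, fun h ↦ ?_⟩
  · have h1 : (⟨P x, apply_mem_X0 hP x⟩ : X0 P) = adjoint (B ∘L sqrtP P ∘L (X0 P).subtypeL)
        ((B ∘L sqrtP P ∘L (X0 P).subtypeL) x) := by
      refine ext_inner_right ℂ fun y ↦ ?_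
      rw [adjoint_inner_left]
      exact (inner_sqrtP hP _ _).symm.trans (inner_map_map_of_isometry hB _ _).symm
    exact congrArg Subtype.val h1
  · have hd : DenseRange (sqrtP P ∘L (X0 P).subtypeL) := by
      rw [DenseRange, range_sqrtP_comp_subtypeL hP]
      exact denseRange_sqrtP P
    refine isometry_of_norm_map_of_denseRange hd fun x ↦ ?_
    have h1 : ⟪P x, x⟫_ℂ = ⟪B (sqrtP P x), B (sqrtP P x)⟫_ℂ := by
      rw [h x]
      exact adjoint_inner_left (B ∘L sqrtP P ∘L (X0 P).subtypeL) x _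
    change ‖B (sqrtP P x)‖ = ‖sqrtP P x‖
    rw [@norm_eq_sqrt_re_inner ℂ, ← h1, ← inner_sqrtP hP, ← @norm_eq_sqrt_re_inner ℂ]

end SquareRoot

/-! ### From the kernel identity to the multiplication operators. -/

section Multipliers

variable {𝒳₀ 𝒰 𝒴 Δ Δs : Type*}
  [NormedAddCommGroup 𝒳₀] [InnerProductSpace ℂ 𝒳₀] [CompleteSpace 𝒳₀]
  [NormedAddCommGroup 𝒰] [InnerProductSpace ℂ 𝒰] [CompleteSpace 𝒰]
  [NormedAddCommGroup 𝒴] [InnerProductSpace ℂ 𝒴] [CompleteSpace 𝒴]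
  [NormedAddCommGroup Δ] [InnerProductSpace ℂ Δ] [CompleteSpace Δ]
  [NormedAddCommGroup Δs] [InnerProductSpace ℂ Δs] [CompleteSpace Δs]

/-- If `K_S(z, ζ) = G(z) K_ℰ(z, ζ) G(ζ)* + Γ(z) Γ(ζ)*`, then `[M_G M_Γ]` is a coisometry of
`H(K_ℰ) ⊕ 𝒳₀` onto `H(K_S)`. -/
theorem exists_multipliers_of_brKernel_eq {S : ℂ → 𝒰 →L[ℂ] 𝒴} {ℰ : ℂ → Δ →L[ℂ] Δs}
    {G : ℂ → Δs →L[ℂ] 𝒴} {Γ : ℂ → 𝒳₀ →L[ℂ] 𝒴}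
    (hKℰ : (brKernel ℰ).PosSemidef) (hKS : (brKernel S).PosSemidef)
    (h : ∀ z ζ : Metric.ball (0 : ℂ) 1, brKernel S z ζ =
      G z ∘L brKernel ℰ z ζ ∘L adjoint (G ζ) + Γ z ∘L adjoint (Γ ζ)) :
    ∃ (MG : BRSpace ℰ hKℰ →L[ℂ] BRSpace S hKS) (MΓ : 𝒳₀ →L[ℂ] BRSpace S hKS),
      (∀ (f : BRSpace ℰ hKℰ) (z : Metric.ball (0 : ℂ) 1), MG f z = G z (f z)) ∧
      (∀ (x : 𝒳₀) (z : Metric.ball (0 : ℂ) 1), MΓ x z = Γ z x) ∧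
      ‖MG‖ ≤ 1 ∧ ‖MΓ‖ ≤ 1 ∧ IsCoisometry (row MG MΓ) := by
  -- The adjoint of `kerFun` at `z` is evaluation at `z`, so the row maps `(f, x)` to `G(z)f(z) +
  -- Γ(z)x` and factors the right-hand side of `h`.
  obtain ⟨W, hW, hWc⟩ := exists_coisometry_of_kernel_eq (K := BRSpace S hKS)
    (fun z : Metric.ball (0 : ℂ) 1 ↦
      row (G z ∘L adjoint (RKHS.kerFun (BRSpace ℰ hKℰ) z)) (Γ z)) (fun z ζ ↦ by
        rw [kernel_BRSpace, h, row_comp_adjoint_row, adjoint_comp, adjoint_adjoint, comp_assoc,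
          ← comp_assoc _ (RKHS.kerFun (BRSpace ℰ hKℰ) ζ), ← RKHS.kernel_apply, kernel_BRSpace])
  refine ⟨W ∘L col (.id ℂ _) 0, W ∘L col 0 (.id ℂ _), fun f z ↦ ?_, fun x z ↦ ?_,
    norm_comp_col_left_le hWc.norm_le_one, norm_comp_col_right_le hWc.norm_le_one, ?_⟩
  · simp [hW]
  · simp [hW]
  · rwa [row_comp_col]

end Multipliers

end BR

/-! ### The main theorem. -/

open BR in
theorem propositionP
    {𝒳 𝒰 𝒴 Δ Δs : Type*}
    [NormedAddCommGroup 𝒳] [InnerProductSpace ℂ 𝒳] [CompleteSpace 𝒳]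
    [NormedAddCommGroup 𝒰] [InnerProductSpace ℂ 𝒰] [CompleteSpace 𝒰]
    [NormedAddCommGroup 𝒴] [InnerProductSpace ℂ 𝒴] [CompleteSpace 𝒴]
    [NormedAddCommGroup Δ] [InnerProductSpace ℂ Δ] [CompleteSpace Δ]
    [NormedAddCommGroup Δs] [InnerProductSpace ℂ Δs] [CompleteSpace Δs]
    -- the data set, and the identifications of the defect spaces with copies of them
    (P T : 𝒳 →L[ℂ] 𝒳) (E : 𝒳 →L[ℂ] 𝒴) (N : 𝒳 →L[ℂ] 𝒰)
    (hD : IsAdmissible P T E N)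
    (i : defect P N ≃ₗᵢ[ℂ] Δ) (is : defectStar P T E ≃ₗᵢ[ℂ] Δs)
    (ℰ : ℂ → Δ →L[ℂ] Δs) (hℰ : IsSchur ℰ)
    -- names for the colligation, its characteristic function `Σ`, and `S`, `G`, `Γ`
    (M : DSum (X0 P) (DSum 𝒰 Δs) →L[ℂ] DSum (X0 P) (DSum 𝒴 Δ))
    (hM : M = colligation P T E N i is)
    (Sg : ℂ → DSum 𝒰 Δs →L[ℂ] DSum 𝒴 Δ) (hSg : Sg = charFun M)
    (S : ℂ → 𝒰 →L[ℂ] 𝒴) (hS : S = redheffer Sg ℰ)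
    (G : ℂ → Δs →L[ℂ] 𝒴) (hG : G = redG Sg ℰ)
    (Γ : ℂ → X0 P →L[ℂ] 𝒴) (hΓ : Γ = redΓ M ℰ G) :
    -- the inverses in the definitions exist, and `S` is a Schur class function
    (∀ z : Metric.ball (0 : ℂ) 1,
      IsUnit (1 - (z : ℂ) • b11 M) ∧ IsUnit (1 - ℰ z ∘L b22 (Sg z))) ∧
    IsSchur S ∧
    -- `F^S = Γ P^{1/2}` on the disk, also where `(I - zT)⁻¹` can be read as an operator inverse
    (∀ (z : Metric.ball (0 : ℂ) 1) (x : 𝒳), FS T E N S z x = Γ z (sqrtP P x)) ∧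
    (∀ z : Metric.ball (0 : ℂ) 1, IsUnit (1 - (z : ℂ) • T) →
      (E - S z ∘L N) ∘L Ring.inverse (1 - (z : ℂ) • T) = Γ z ∘L sqrtP P) ∧
    -- the kernels are positive, and `G`, `Γ` are contractive multipliers
    ∃ (hKℰ : (brKernel ℰ).PosSemidef) (hKS : (brKernel S).PosSemidef)
      (MG : BRSpace ℰ hKℰ →L[ℂ] BRSpace S hKS) (MΓ : X0 P →L[ℂ] BRSpace S hKS),
      (∀ (f : BRSpace ℰ hKℰ) (z : Metric.ball (0 : ℂ) 1), MG f z = G z (f z)) ∧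
      (∀ (x : X0 P) (z : Metric.ball (0 : ℂ) 1), MΓ x z = Γ z x) ∧
      ‖MG‖ ≤ 1 ∧ ‖MΓ‖ ≤ 1 ∧
      IsCoisometry (row MG MΓ) ∧
      (Isometry MΓ → IsPartialIsometry MG) ∧
      -- `P = M_{F^S}^{[*]} M_{F^S}` with `M_{F^S} = M_Γ P^{1/2}`, on `𝒳` and on `𝒳₀`
      (Isometry MΓ ↔ P = adjoint (MΓ ∘L sqrtP P) ∘L (MΓ ∘L sqrtP P)) ∧
      ((Isometry MΓ ∧ IsPartialIsometry MG) ↔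
        ∀ x : X0 P, P x = adjoint (MΓ ∘L sqrtP P ∘L (X0 P).subtypeL)
          ((MΓ ∘L sqrtP P ∘L (X0 P).subtypeL) x)) := by
  subst hS hG hΓ hSg
  have hMc : IsCoisometry M := hM ▸ hD.isCoisometry_colligation i is
  have h0 : b22 (b22 M) = 0 := b22_b22_colligation i is hM
  have hA : ∀ z : Metric.ball (0 : ℂ) 1, IsUnit (1 - (z : ℂ) • b11 M) := fun z ↦
    isUnit_one_sub_smul (norm_b11_le hMc.norm_le_one) (mem_ball_zero_iff.1 z.2)
  have hu : ∀ z : Metric.ball (0 : ℂ) 1, IsUnit (1 - ℰ z ∘L b22 (charFun M z)) := fun z ↦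
    isUnit_one_sub_comp_b22 hMc h0 hℰ (mem_ball_zero_iff.1 z.2)
  have hS : IsSchur (redheffer (charFun M) ℰ) := hℰ.redheffer hMc h0
  have hFS : ∀ (z : Metric.ball (0 : ℂ) 1) (x : 𝒳), FS T E N (redheffer (charFun M) ℰ) z x =
      redΓ M ℰ (redG (charFun M) ℰ) z (sqrtP P x) := fun z x ↦
    hD.FS_eq i is ℰ hM (mem_ball_zero_iff.1 z.2) (hu z) x
  refine ⟨fun z ↦ ⟨hA z, hu z⟩, hS, hFS, fun z hT ↦ ?_, hℰ.posSemidef_brKernel,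
    hS.posSemidef_brKernel, ?_⟩
  · ext x
    rw [coe_comp (redΓ M ℰ (redG (charFun M) ℰ) z), Function.comp_apply, ← hFS z x, FS,
      obs_eq_inverse hD.output_E (mem_ball_zero_iff.1 z.2) hT,
      obs_eq_inverse hD.output_N (mem_ball_zero_iff.1 z.2) hT]
    rfl
  · obtain ⟨MG, MΓ, hMG, hMΓ, hnG, hnΓ, hco⟩ := exists_multipliers_of_brKernel_eq
      (G := redG (charFun M) ℰ) (Γ := redΓ M ℰ (redG (charFun M) ℰ))
      hℰ.posSemidef_brKernel hS.posSemidef_brKernel fun z ζ ↦ by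
        have hne : 1 - (z : ℂ) * star (ζ : ℂ) ≠ 0 :=
          one_sub_mul_star_ne_zero (mem_ball_zero_iff.1 z.2).le (mem_ball_zero_iff.1 ζ.2)
        simp only [brKernel, Matrix.of_apply]
        rw [one_sub_redheffer_comp_adjoint hMc (hA z) (hA ζ) (hu z) (hu ζ), smul_add,
          inv_smul_smul₀ hne, smul_comp, comp_smul]
    -- Isometry of `M_Γ` already forces `M_G` to be a partial isometry, so the last equivalence
    -- reduces to this criterion.
    have hiso := isometry_iff_forall_eq_adjoint_apply hD.pos MΓ
    refine ⟨MG, MΓ, hMG, hMΓ, hnG, hnΓ, hco, hco.isPartialIsometry_left,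
      isometry_iff_eq_adjoint_comp hD.pos MΓ, fun h ↦ hiso.1 h.1, fun h ↦ ?_⟩
    exact ⟨hiso.2 h, hco.isPartialIsometry_left (hiso.2 h)⟩
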